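/- **Setting.** A *process* for parties $1,\dots,n$ is a family of conditional probability distributions $p(o^1,\dots,o^n\mid s^1,\dots,s^n)$ of outcomes given settings. It is *causal* if it is the marginal of some $p(\kappa,o^1,\dots,o^n\mid s^1,\dots,s^n)$, with $\kappa$ a random strict partial order on the parties, such that for every party $A$, every set $\mathcal X$ of other parties, every strict partial order $\kappa_0$ on $\{A\}\cup\mathcal X$ and all values $o^{\mathcal X}$, the probability that $\kappa$ restricts to $\kappa_0$ on $\{A\}\cup\mathcal X$, that no $X\in\mathcal X$ is in the future of $A$, and that the outcomes in $\mathcal X$ are $o^{\mathcal X}$, does not depend on the setting $s^A$. Let party $X$ have a finite-dimensional input system $X_1$ and output system $X_2$. Its settings are all quantum instruments $\{\mathcal M^X_j\}_j$ from $X_1$ to $X_2$ (finitely many nonzero completely positive maps with trace-preserving sum), and $M^{X_1X_2}_j=[(\mathcal I\otimes\mathcal M^X_j)(|\phi^+\rangle\langle\phi^+|)]^{T}$, $|\phi^+\rangle=\sum_k|kk\rangle$, is the Choi–Jamiołkowski operator. A *process matrix* is an operator $W\ge 0$ on all inputs and outputs with $\mathrm{Tr}[W\bigotimes_X M^{X_1X_2}]=1$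 whenever $M^{X_1X_2}\ge0$ and $\mathrm{Tr}_{X_2}M^{X_1X_2}=\mathbb 1^{X_1}$ for all $X$. It describes the *quantum process* with probabilities $\mathrm{Tr}[W\bigotimes_X M^{X_1X_2}_{o^X}]$. A quantum process is *causally separable* (recursively in $n$; the process without parties is causally separable) if it is a convex mixture $\sum_i q_i\mathcal W_i$ of quantum processes $\mathcal W_i$ such that in $\mathcal W_i$ the other parties do not signal to party $i$ and, for every event (setting and outcome) of party $i$ of nonzero probability, the conditional process of the remaining $n-1$ parties is a causally separable quantum process. For two distinct parties $A,B$ of a process (any other parties having fixed settings), and uniformly random bits $a,b,b'$, let $A$ use a setting depending on $a$ and output $x$, and $B$ use a setting depending on $(b,b')$ and output $y$; put $p_{\rm succ}=\tfrac12\left[P(x=b\mid b'=0)+P(y=a\mid b'=1)\right]$. The *OCB causal inequality* is $p_{\rm succ}\le \tfrac34$. **Theorem.** Let $A_1,A_2,B_1,B_2,C_2$ be qubits, let $C_1$ be trivial (one-dimensional), and let $$W=\tfrac14\Big(\mathbb 1+\tfrac1{\sqrt2}\,\sigma_z^{A_1}\sigma_z^{B_1}\sigma_z^{B_2}\sigma_x^{C_2}+\tfrac1{\sqrt2}\,\sigma_z^{A_2}\sigma_z^{B_1}\sigma_z^{C_2}\Big).$$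 1. $W$ is a process matrix, and the tripartite quantum process it describes is causally separable and causal. 2. The OCB inequality is a causal inequality: every causal process satisfies $p_{\rm succ}\le\frac34$, for any two of its parties, any fixed settings of the others, and any choice of the settings used by the two parties. 3. Let $B_1'$, $C_1'$ be qubits added to the input systems of Bob and Charlie in the state $\frac12|\Phi^+\rangle\langle\Phi^+|^{C_1'B_1'}$, $|\Phi^+\rangle=|00\rangle+|11\rangle$. Then $W\otimes\frac12|\Phi^+\rangle\langle\Phi^+|^{C_1'B_1'}$ is a process matrix and the process it describes is not causal. Moreover, when Charlie performs the identity channel from $C_1'$ to $C_2$, there are instruments for Alice (depending on $a$) and Bob (depending on $b,b'$) for which $p_{\rm succ}>\frac34$, violating the OCB inequality. -/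

import Mathlib

open scoped ComplexOrder Kronecker ENNReal

noncomputable section

namespace ProcessFramework

/-! ### Processes and causality (theory-independent) -/

/-- A process for the parties `ι`: for each choice of settings `s i ∈ S i`, a probability
distribution `p(o | s)` of the joint outcome `o`, with `o i ∈ O i`. -/
abbrev CondProcess {ι : Type*} (S O : ι → Type*) : Type _ :=
  (∀ i, S i) → PMF (∀ i, O i)

/-- Strict partial orders (causal configurations) on the set of parties. Antisymmetry follows
from irreflexivity and transitivity. -/
structure SPO (ι : Type*) where
  /-- `prec a b`: `a` is in the causal past of `b`. -/
  prec : ι → ι → Prop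
  irrefl : ∀ a, ¬ prec a a
  trans : ∀ a b c, prec a b → prec b c → prec a c

/-- The event "the restriction of the causal configuration to `{A} ∪ X` is that of `κ₀`, no party
of `X` is in the causal future of `A`, and the outcomes in `X` are those of `o₀`".
(Every order on `{A} ∪ X` is the restriction of some `κ₀`.) -/
def pastEvent {ι : Type*} {O : ι → Type*} (A : ι) (X : Set ι) (κ₀ : SPO ι) (o₀ : ∀ i, O i) :
    Set (SPO ι × (∀ i, O i)) :=
  {e | (∀ x ∈ insert A X, ∀ y ∈ insert A X, (e.1.prec x y ↔ κ₀.prec x y)) ∧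
    (∀ x ∈ X, ¬ e.1.prec A x) ∧ ∀ x ∈ X, e.2 x = o₀ x}

/-- A process is causal if there is a joint conditional distribution `J` of a random causal
configuration and of the outcomes, with the process as its marginal, such that the probability of
each event `pastEvent A X κ₀ o₀`, `A ∉ X`, does not depend on the setting of `A`. -/
def IsCausal {ι : Type*} {S O : ι → Type*} (P : CondProcess S O) : Prop :=
  ∃ J : (∀ i, S i) → PMF (SPO ι × (∀ i, O i)),
    (∀ s, (J s).map Prod.snd = P s) ∧
    ∀ (A : ι) (X : Set ι), A ∉ X → ∀ (κ₀ : SPO ι) (o₀ : ∀ i, O i) (s s' : ∀ i, S i),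
      (∀ i, i ≠ A → s i = s' i) →
        (J s).toOuterMeasure (pastEvent A X κ₀ o₀) =
          (J s').toOuterMeasure (pastEvent A X κ₀ o₀)

/-- The success probability `½ [P(x = b | b' = 0) + P(y = a | b' = 1)]` in the guessing game of
Oreshkov, Costa and Brukner, played by two parties `A` and `B` of the process `P`: for uniformly
random bits `a, b, b'`, party `A` uses setting `α a` and outputs `x`, party `B` uses
setting `β b b'` and outputs `y`; all other parties use their fixed settings in `s₀`. -/
def ocbSuccess {ι : Type*} [DecidableEq ι] {S : ι → Type*} (P : CondProcess S (fun _ => ℕ))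
    (A B : ι) (s₀ : ∀ i, S i) (α : Fin 2 → S A) (β : Fin 2 → Fin 2 → S B) : ℝ :=
  let p : Fin 2 → Fin 2 → Fin 2 → PMF (ι → ℕ) := fun a b b' =>
    P (Function.update (Function.update s₀ A (α a)) B (β b b'))
  (1 / 2) *
    ((1 / 4) * ∑ a : Fin 2, ∑ b : Fin 2, ((p a b 0).toOuterMeasure {o | o A = (b : ℕ)}).toReal +
     (1 / 4) * ∑ a : Fin 2, ∑ b : Fin 2, ((p a b 1).toOuterMeasure {o | o B = (a : ℕ)}).toReal)

/-! ### Quantum operations -/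

/-- Complete positivity, in Kraus form. -/
def IsCP {a b : Type} [Fintype a] (Φ : Matrix a a ℂ →ₗ[ℂ] Matrix b b ℂ) : Prop :=
  ∃ (m : ℕ) (E : Fin m → Matrix b a ℂ), ∀ σ, Φ σ = ∑ k, E k * σ * (E k).conjTranspose

/-- A quantum operation (instrument) from the input system to the output system. Outcomes are
labelled by natural numbers, and all but finitely many of them never occur. -/
structure Instrument (a b : Type) [Fintype a] [Fintype b] where
  /-- The completely positive map induced by each outcome. -/
  map : ℕ → (Matrix a a ℂ →ₗ[ℂ] Matrix b b ℂ)
  isCP : ∀ j, IsCP (map j)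
  tracePreserving : ∃ N : ℕ, (∀ j, N ≤ j → map j = 0) ∧
    ∀ σ : Matrix a a ℂ, (∑ j ∈ Finset.range N, map j σ).trace = σ.trace

/-- The Choi-Jamiołkowski operator `[(id ⊗ Φ)(|φ⁺⟩⟨φ⁺|)]ᵀ` with `|φ⁺⟩ = ∑ⱼ |jj⟩`. -/
def choi {a b : Type} [DecidableEq a] (Φ : Matrix a a ℂ →ₗ[ℂ] Matrix b b ℂ) :
    Matrix (a × b) (a × b) ℂ :=
  (Matrix.of fun p q : a × b => Φ (Matrix.single p.1 q.1 1) p.2 q.2).transpose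

/-- Partial trace over the output system. -/
def traceOut {a b : Type} [Fintype b] (M : Matrix (a × b) (a × b) ℂ) : Matrix a a ℂ :=
  Matrix.of fun i j => ∑ k, M (i, k) (j, k)

/-- The tensor product of a family of operators, one for each party. -/
def tensor {n : ℕ} {X : Fin n → Type} (M : ∀ i, Matrix (X i) (X i) ℂ) :
    Matrix (∀ i, X i) (∀ i, X i) ℂ :=
  Matrix.of fun x y => ∏ i, M i (x i) (y i)

/-! ### Quantum processes

The input and output systems of party `i` have orthonormal bases labelled by `In i`, `Out i`. -/

section Quantum

variable {n : ℕ} {In Out : Fin n → Type}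

/-- Operators on the tensor product of all input and output systems. -/
abbrev POp (In Out : Fin n → Type) : Type :=
  Matrix (∀ i, In i × Out i) (∀ i, In i × Out i) ℂ

/-- A process whose settings are all the quantum operations on the given systems. -/
abbrev InstrProcess (In Out : Fin n → Type) [∀ i, Fintype (In i)] [∀ i, Fintype (Out i)] : Type :=
  CondProcess (fun i => Instrument (In i) (Out i)) (fun _ => ℕ)

/-- CondProcess matrices: positive semidefinite, and normalized on all tuples of
Choi-Jamiołkowski operators of trace-preserving completely positive maps. -/
def IsProcessMatrix [∀ i, Fintype (In i)] [∀ i, DecidableEq (In i)] [∀ i, Fintype (Out i)]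
    (W : POp In Out) : Prop :=
  W.PosSemidef ∧
    ∀ M : ∀ i, Matrix (In i × Out i) (In i × Out i) ℂ,
      (∀ i, (M i).PosSemidef) → (∀ i, traceOut (M i) = 1) → (W * tensor M).trace = 1

/-- `P` is the process described by `W`: `p(o | s) = Tr [W (⨂ᵢ Mᵢ)]`, where `Mᵢ` is the
Choi-Jamiołkowski operator of the event `(s i, o i)`. At most one `P` is described by a given `W`,
and exactly one if `W` is a process matrix. -/
def Describes [∀ i, Fintype (In i)] [∀ i, DecidableEq (In i)] [∀ i, Fintype (Out i)]
    (W : POp In Out) (P : InstrProcess In Out) : Prop :=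
  ∀ s o, ((P s o).toReal : ℂ) = (W * tensor fun i => choi ((s i).map (o i))).trace

/-- Quantum processes: those described by a process matrix. -/
def IsQuantum [∀ i, Fintype (In i)] [∀ i, DecidableEq (In i)] [∀ i, Fintype (Out i)]
    (P : InstrProcess In Out) : Prop :=
  ∃ W : POp In Out, IsProcessMatrix W ∧ Describes W P

/-- The operator `W ⊗ ρ` obtained when the input system of each party `i` is extended by an
ancilla with basis `Anc i`, and the ancillas are prepared in the joint state `ρ`. -/
def extend {Anc : Fin n → Type} (W : POp In Out) (ρ : Matrix (∀ i, Anc i) (∀ i, Anc i) ℂ) :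
    POp (fun i => In i × Anc i) Out :=
  Matrix.of fun x y =>
    W (fun i => ((x i).1.1, (x i).2)) (fun i => ((y i).1.1, (y i).2)) *
      ρ (fun i => (x i).1.2) (fun i => (y i).1.2)

end Quantum

/-- Causally separable quantum processes, by recursion on the number of parties: mixtures, with
weights `q i`, of quantum processes `Q i` each of which is the composition `cond ∘ R` of a process
`R` of party `i` alone and of a conditional process `cond` of the other parties, which is a
causally separable quantum process for every event `(t, k)` of party `i` of nonzero probability.
The process without parties is causally separable. -/
def IsCausallySeparable : {n : ℕ} → {In Out : Fin n → Type} → [∀ i, Fintype (In i)] →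
    [∀ i, DecidableEq (In i)] → [∀ i, Fintype (Out i)] → InstrProcess In Out → Prop
  | 0, _, _, _, _, _, _ => True
  | n + 1, In, Out, _, _, _, P =>
    IsQuantum P ∧
    ∃ (q : PMF (Fin (n + 1))) (Q : Fin (n + 1) → InstrProcess In Out),
      (∀ s, P s = q.bind fun i => Q i s) ∧
      ∀ i, IsQuantum (Q i) ∧
        ∃ (R : Instrument (In i) (Out i) → PMF ℕ)
          (cond : Instrument (In i) (Out i) → ℕ →
            InstrProcess (fun j => In (i.succAbove j)) (fun j => Out (i.succAbove j))),
          (∀ s o, Q i s o = R (s i) (o i) *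
            cond (s i) (o i) (fun j => s (i.succAbove j)) (fun j => o (i.succAbove j))) ∧
          ∀ t k, R t k ≠ 0 → IsCausallySeparable (cond t k)

/-! ### The example

Party `0` is Alice, party `1` is Bob, party `2` is Charlie. -/

def σx : Matrix (Fin 2) (Fin 2) ℂ := !![0, 1; 1, 0]

def σz : Matrix (Fin 2) (Fin 2) ℂ := !![1, 0; 0, -1]

/-- Dimensions of the input systems `A₁`, `B₁`, `C₁`: Charlie's is trivial. -/
def dimIn : Fin 3 → ℕ := ![2, 2, 1]

/-- Dimensions of the input ancillas: qubits `B₁'` and `C₁'`, and none for Alice. -/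
def dimAnc : Fin 3 → ℕ := ![1, 2, 2]

/-- The basis labels of the input systems. -/
abbrev Inp (i : Fin 3) : Type := Fin (dimIn i)

/-- The basis labels of the output systems `A₂`, `B₂`, `C₂`, which are qubits. -/
abbrev Outp (_ : Fin 3) : Type := Fin 2

/-- The basis labels of the ancillary input systems. -/
abbrev Ancil (i : Fin 3) : Type := Fin (dimAnc i)

/-- A product operator `a ⊗ b ⊗ c` on the systems `A₁A₂`, `B₁B₂`, `C₁C₂`. -/
def prodOp (a b : Matrix (Fin 2 × Fin 2) (Fin 2 × Fin 2) ℂ)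
    (c : Matrix (Fin 1 × Fin 2) (Fin 1 × Fin 2) ℂ) : POp Inp Outp :=
  tensor fun i : Fin 3 => match i with
    | 0 => a
    | 1 => b
    | 2 => c

/-- `¼ (1 + (1/√2) σz^{A₁} σz^{B₁} σz^{B₂} σx^{C₂} + (1/√2) σz^{A₂} σz^{B₁} σz^{C₂})`. -/
def WABC : POp Inp Outp :=
  (1 / 4 : ℂ) •
    (1 + ((1 / √2 : ℝ) : ℂ) • prodOp (σz ⊗ₖ 1) (σz ⊗ₖ σz) (1 ⊗ₖ σx)
      + ((1 / √2 : ℝ) : ℂ) • prodOp (1 ⊗ₖ σz) (σz ⊗ₖ 1) (1 ⊗ₖ σz))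

/-- The maximally entangled state `½ |Φ⁺⟩⟨Φ⁺|` of `B₁'` and `C₁'`, `|Φ⁺⟩ = |00⟩ + |11⟩`. -/
def maxEntangled : Matrix (∀ i, Ancil i) (∀ i, Ancil i) ℂ :=
  Matrix.of fun x y =>
    if (x 1 : ℕ) = (x 2 : ℕ) ∧ (y 1 : ℕ) = (y 2 : ℕ) then 1 / 2 else 0

/-- The deterministic operation of Charlie (with a single outcome, `0`) that is the identity
channel from the ancilla `C₁'` to `C₂`. -/
def IsCharlieIdentity (t : Instrument (Inp 2 × Ancil 2) (Outp 2)) : Prop :=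
  ∀ (σ : Matrix (Fin 1 × Fin 2) (Fin 1 × Fin 2) ℂ) (k l : Fin 2),
    t.map 0 σ k l = σ (0, k) (0, l)

end ProcessFramework

end

open ProcessFramework

/-! Write W = ¼(1 + (S + T)/√2), where S and T are tensor products of reflections that commute at
Alice and Bob but anticommute at Charlie (σx against σz). Then (S + T)/√2 is again a reflection, so
W ≥ 0. Alice's factor of S and Bob's factor of T are σz ⊗ 1 with σz on the input, so both terms have
zero expectation in all deterministic operations; this is the normalization
(`isProcessMatrix_WABC`).

Separability: Charlie acts first. An event M of Charlie leaves ¼(1 + uS' + vT') for Alice and Bob,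
with u = Tr(S₂M)/(√2 Tr M) and v likewise from T₂. Each ±u ± v is the expectation of a reflection,
because the two factors at Charlie anticommute; hence |u| + |v| ≤ 1
(`IsReflection.abs_add_abs_re_trace_mul_le`). The remainder is then a mixture of a process with only
the S' term, where only Bob can signal to Alice, and one with only the T' term, where only Alice can
signal to Bob (`isCausallySeparable_of_describes_mixOp_two`). Causality follows by recursion on the
parties: draw the first party and its outcome, and put it before a random configuration of the
others (`isCausal_of_mixture`).

OCB inequality: the probabilities that A does not precede B and that B does not precede A do not
depend on the two settings, and they add up to at least 1. Where the guesser does not follow the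
sender, its outcome is independent of the bit to be guessed, so it is right at most half of the time
(`IsCausal.ocbSuccess_le`).

Violation: the entangled pair followed by Charlie's identity channel moves Charlie's Pauli operators
to Bob's ancilla. By his choice of basis on the ancilla, Bob selects after the fact which of the two
terms is active: the conjugate basis lets him signal to Alice, the computational basis lets him
receive from her. Both guesses succeed with probability (1 + 1/√2)/2 > 3/4 (`exists_lt_ocbSuccess`).
-/

namespace ProcessFramework

/-! ### Tensor products over the parties -/

section Tensor

variable {n : ℕ} {X : Fin n → Type}

theorem tensor_mul [∀ i, Fintype (X i)] (M N : ∀ i, Matrix (X i) (X i) ℂ) :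
    tensor M * tensor N = tensor fun i => M i * N i := by
  ext x y
  simp only [tensor, Matrix.mul_apply, Matrix.of_apply, Finset.prod_univ_sum,
    Fintype.piFinset_univ, Finset.prod_mul_distrib]

theorem tensor_conjTranspose (M : ∀ i, Matrix (X i) (X i) ℂ) :
    (tensor M).conjTranspose = tensor fun i => (M i).conjTranspose := by
  ext x y
  simp [tensor, Matrix.conjTranspose_apply]

theorem trace_tensor [∀ i, Fintype (X i)] (M : ∀ i, Matrix (X i) (X i) ℂ) :
    (tensor M).trace = ∏ i, (M i).trace := by
  simp only [tensor, Matrix.trace, Matrix.diag, Matrix.of_apply, Finset.prod_univ_sum,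
    Fintype.piFinset_univ]

theorem trace_tensor_mul_tensor [∀ i, Fintype (X i)] (M N : ∀ i, Matrix (X i) (X i) ℂ) :
    (tensor M * tensor N).trace = ∏ i, (M i * N i).trace := by
  rw [tensor_mul, trace_tensor]

theorem tensor_one [∀ i, DecidableEq (X i)] : tensor (fun i => (1 : Matrix (X i) (X i) ℂ)) = 1 := by
  ext x y
  simp only [tensor, Matrix.of_apply, Matrix.one_apply, Finset.prod_ite_zero, Finset.mem_univ,
    true_implies, Finset.prod_const_one, funext_iff]

theorem tensor_sum {α : Type*} (s : Fin n → Finset α) (M : ∀ i, α → Matrix (X i) (X i) ℂ) :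
    tensor (fun i => ∑ a ∈ s i, M i a) =
      ∑ o ∈ Fintype.piFinset s, tensor fun i => M i (o i) := by
  ext x y
  simp only [tensor, Matrix.of_apply, Matrix.sum_apply, Finset.prod_univ_sum]

theorem _root_.Matrix.PosSemidef.exists_eq_conjTranspose_mul_self {m : Type*} [Fintype m]
    {M : Matrix m m ℂ} (hM : M.PosSemidef) : ∃ B : Matrix m m ℂ, M = B.conjTranspose * B := by
  classical
  open scoped MatrixOrder in
  exact CStarAlgebra.nonneg_iff_eq_star_mul_self.mp hM.nonneg

theorem posSemidef_tensor [∀ i, Fintype (X i)] {M : ∀ i, Matrix (X i) (X i) ℂ}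
    (h : ∀ i, (M i).PosSemidef) : (tensor M).PosSemidef := by
  choose B hB using fun i => (h i).exists_eq_conjTranspose_mul_self
  obtain rfl : M = fun i => (B i).conjTranspose * B i := funext hB
  rw [← tensor_mul, ← tensor_conjTranspose]
  exact Matrix.posSemidef_conjTranspose_mul_self _

theorem trace_mul_nonneg {m : Type*} [Fintype m] {M N : Matrix m m ℂ} (hM : M.PosSemidef)
    (hN : N.PosSemidef) : 0 ≤ (M * N).trace := by
  obtain ⟨B, rfl⟩ := hM.exists_eq_conjTranspose_mul_self
  rw [Matrix.mul_assoc, Matrix.trace_mul_comm]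
  exact (hN.mul_mul_conjTranspose_same B).trace_nonneg

theorem tensor_eq_zero {M : ∀ i, Matrix (X i) (X i) ℂ} {i : Fin n} (h : M i = 0) :
    tensor M = 0 := by
  ext x y
  exact Finset.prod_eq_zero (Finset.mem_univ i) (by rw [h]; rfl)

end Tensor

/-! ### Choi operators -/

section Choi

variable {a b : Type}

theorem choi_sum [DecidableEq a] {α : Type*} (s : Finset α)
    (Φ : α → (Matrix a a ℂ →ₗ[ℂ] Matrix b b ℂ)) : choi (∑ k ∈ s, Φ k) = ∑ k ∈ s, choi (Φ k) := by
  ext p q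
  simp [choi, Matrix.sum_apply]

theorem choi_zero [DecidableEq a] : choi (0 : Matrix a a ℂ →ₗ[ℂ] Matrix b b ℂ) = 0 := by
  ext p q
  simp [choi]

theorem mul_single_mul_apply {a b c d : Type*} [Fintype a] [DecidableEq a] [Fintype c]
    [DecidableEq c] (A : Matrix b a ℂ) (B : Matrix c d ℂ) (i : a) (j : c) (r : b) (s : d) :
    (A * Matrix.single i j (1 : ℂ) * B) r s = A r i * B j s := by
  rw [Matrix.mul_assoc, Matrix.mul_apply, Finset.sum_eq_single i, Matrix.single_mul_apply_same,
    one_mul]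
  · intro k _ hk
    rw [Matrix.single_mul_apply_of_ne _ _ _ _ _ hk, mul_zero]
  · simp

/-- Each Kraus operator contributes a rank-one positive operator; the conjugated vector comes from
the transpose in `choi`. -/
theorem posSemidef_choi [Fintype a] [DecidableEq a] [Finite b]
    {Φ : Matrix a a ℂ →ₗ[ℂ] Matrix b b ℂ} (h : IsCP Φ) : (choi Φ).PosSemidef := by
  obtain ⟨m, E, hE⟩ := h
  have : choi Φ = ∑ k, Matrix.vecMulVec (star fun p : a × b => E k p.2 p.1)
      (star (star fun p : a × b => E k p.2 p.1)) := by
    ext p q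
    simp only [choi, hE, Matrix.transpose_apply, Matrix.of_apply, Matrix.sum_apply,
      mul_single_mul_apply, Matrix.conjTranspose_apply, Matrix.vecMulVec_apply, star_star,
      Pi.star_apply]
    exact Finset.sum_congr rfl fun k _ => mul_comm _ _
  rw [this]
  exact Matrix.posSemidef_sum _ fun k _ => Matrix.posSemidef_vecMulVec_self_star _

theorem traceOut_choi [Fintype a] [DecidableEq a] [Fintype b]
    {Φ : Matrix a a ℂ →ₗ[ℂ] Matrix b b ℂ} (h : ∀ σ, (Φ σ).trace = σ.trace) :
    traceOut (choi Φ) = 1 := by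
  ext i j
  have := h (Matrix.single j i 1)
  simp only [Matrix.trace, Matrix.diag] at this
  simp only [traceOut, choi, Matrix.of_apply, Matrix.transpose_apply, this, Matrix.one_apply,
    Matrix.single_apply, ite_and]
  simp

theorem trace_traceOut [Fintype a] [Fintype b] (M : Matrix (a × b) (a × b) ℂ) :
    (traceOut M).trace = M.trace := by
  simp [traceOut, Matrix.trace, Fintype.sum_prod_type]

theorem trace_kronecker_one_mul [Fintype a] [Fintype b] [DecidableEq b] (D : Matrix a a ℂ)
    (M : Matrix (a × b) (a × b) ℂ) : ((D ⊗ₖ (1 : Matrix b b ℂ)) * M).trace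
      = (D * traceOut M).trace := by
  simp only [traceOut, Matrix.trace, Fintype.sum_prod_type, Matrix.diag, Matrix.mul_apply,
    Matrix.kroneckerMap_apply, Matrix.one_apply, Matrix.of_apply, mul_ite, mul_one, mul_zero,
    ite_mul, zero_mul, Finset.sum_ite_eq, Finset.mem_univ, if_true, Finset.mul_sum]
  exact Finset.sum_congr rfl fun i _ => Finset.sum_comm

/-- Evaluates probabilities directly from the map, without writing down its Choi operator; the
transpose in `choi` ends up on `F`. -/
theorem trace_kronecker_mul_choi [Fintype a] [DecidableEq a] [Fintype b]
    (D : Matrix a a ℂ) (F : Matrix b b ℂ) (Φ : Matrix a a ℂ →ₗ[ℂ] Matrix b b ℂ) :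
    ((D ⊗ₖ F) * choi Φ).trace = (F.transpose * Φ D).trace := by
  have hD : Φ D = ∑ i, ∑ j, D i j • Φ (Matrix.single i j 1) := by
    conv_lhs => rw [Matrix.matrix_eq_sum_single D]
    simp only [map_sum, ← map_smul, Matrix.smul_single, smul_eq_mul, mul_one]
  rw [hD]
  simp only [Matrix.trace, Fintype.sum_prod_type, Matrix.diag, Matrix.mul_apply,
    Matrix.kroneckerMap_apply, choi, Matrix.of_apply, Matrix.transpose_apply, Matrix.sum_apply,
    Matrix.smul_apply, smul_eq_mul, Finset.mul_sum]
  have e (f : a → b → a → b → ℂ) : ∑ i, ∑ r, ∑ j, ∑ s, f i r j s =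
      ∑ s, ∑ r, ∑ i, ∑ j, f i r j s := by
    rw [Finset.sum_comm]
    trans ∑ r, ∑ s, ∑ i, ∑ j, f i r j s
    · exact Finset.sum_congr rfl fun r _ =>
        (Finset.sum_congr rfl fun i _ => Finset.sum_comm).trans Finset.sum_comm
    · exact Finset.sum_comm
  rw [e]
  refine Finset.sum_congr rfl fun s _ => Finset.sum_congr rfl fun r _ =>
    Finset.sum_congr rfl fun i _ => Finset.sum_congr rfl fun j _ => ?_
  ring

end Choi

/-! ### Processes described by process matrices -/

theorem exists_pmf {α : Type*} (g : α → ℂ) (hg : ∀ x, 0 ≤ g x) (s : Finset α)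
    (hs : ∑ x ∈ s, g x = 1) (hs' : ∀ x ∉ s, g x = 0) :
    ∃ p : PMF α, ∀ x, ((p x).toReal : ℂ) = g x := by
  have hre (x) : ((g x).re : ℂ) = g x :=
    (Complex.eq_re_of_ofReal_le (r := 0) (by simpa using hg x)).symm
  have hre' (x) : 0 ≤ (g x).re := (Complex.le_def.1 (hg x)).1
  refine ⟨PMF.ofFinset (fun x => ENNReal.ofReal (g x).re) s ?_ ?_, fun x => ?_⟩
  · rw [← ENNReal.ofReal_sum_of_nonneg fun x _ => hre' x, ← Complex.re_sum, hs]
    simp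
  · intro x hx
    simp [hs' x hx]
  · rw [PMF.ofFinset_apply, ENNReal.toReal_ofReal (hre' x), hre]

theorem Instrument.sum_choi {a b : Type} [Fintype a] [DecidableEq a] [Fintype b]
    (t : Instrument a b) : ∃ N : ℕ, (∀ j, N ≤ j → choi (t.map j) = 0) ∧
      (∑ j ∈ Finset.range N, choi (t.map j)).PosSemidef ∧
      traceOut (∑ j ∈ Finset.range N, choi (t.map j)) = 1 := by
  obtain ⟨N, h0, htr⟩ := t.tracePreserving
  refine ⟨N, fun j hj => by rw [h0 j hj, choi_zero],
    Matrix.posSemidef_sum _ fun j _ => posSemidef_choi (t.isCP j), ?_⟩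
  rw [← choi_sum]
  exact traceOut_choi fun σ => by rw [LinearMap.sum_apply, htr]

variable {n : ℕ} {In Out : Fin n → Type} [∀ i, Fintype (In i)] [∀ i, DecidableEq (In i)]
  [∀ i, Fintype (Out i)]

/-- Summing over all outcomes replaces each party's event by a trace-preserving operation, so the
total probability is the normalization of `W`. -/
theorem IsProcessMatrix.exists_describes {W : POp In Out} (hW : IsProcessMatrix W) :
    ∃ P : InstrProcess In Out, Describes W P := by
  have (s : ∀ i, Instrument (In i) (Out i)) : ∃ p : PMF (Fin n → ℕ), ∀ o,
      ((p o).toReal : ℂ) = (W * tensor fun i => choi ((s i).map (o i))).trace := by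
    choose N h0 hpos htr using fun i => (s i).sum_choi
    refine exists_pmf _ (fun o => trace_mul_nonneg hW.1
      (posSemidef_tensor fun i => posSemidef_choi ((s i).isCP _)))
      (Fintype.piFinset fun i => Finset.range (N i)) ?_ ?_
    · rw [← Matrix.trace_sum, ← Finset.mul_sum,
        ← tensor_sum (fun i => Finset.range (N i)) (fun i j => choi ((s i).map j))]
      exact hW.2 _ hpos htr
    · intro o ho
      simp only [Fintype.mem_piFinset, Finset.mem_range, not_forall, not_lt] at ho
      obtain ⟨i, hi⟩ := ho
      rw [tensor_eq_zero (i := i) (h0 i _ hi), mul_zero, Matrix.trace_zero]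
  choose P hP using this
  exact ⟨P, hP⟩

/-! ### Reflections and their expectations -/

/-- An operator on the input and output systems of a party with vanishing expectation in all
trace-preserving operations, such as a traceless operator on the input system. -/
def InputTraceless {a b : Type} [Fintype a] [DecidableEq a] [Fintype b]
    (S : Matrix (a × b) (a × b) ℂ) : Prop :=
  ∀ M, traceOut M = 1 → (S * M).trace = 0

theorem inputTraceless_kronecker_one {a b : Type} [Fintype a] [DecidableEq a] [Fintype b]
    [DecidableEq b] {D : Matrix a a ℂ} (hD : D.trace = 0) :
    InputTraceless (D ⊗ₖ (1 : Matrix b b ℂ)) := fun M hM => by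
  rw [trace_kronecker_one_mul, hM, mul_one, hD]

/-- Hermitian involutions. -/
structure IsReflection {m : Type*} [Fintype m] [DecidableEq m] (S : Matrix m m ℂ) : Prop where
  isHermitian : S.IsHermitian
  mul_self : S * S = 1

theorem IsReflection.neg {m : Type*} [Fintype m] [DecidableEq m] {S : Matrix m m ℂ}
    (h : IsReflection S) : IsReflection (-S) :=
  ⟨h.1.neg, by rw [neg_mul_neg, h.2]⟩

/-- `(1 + S)² = 2 (1 + S)`, so `1 + S` is twice a projection. -/
theorem IsReflection.posSemidef_one_add {m : Type*} [Fintype m] [DecidableEq m]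
    {S : Matrix m m ℂ} (h : IsReflection S) : (1 + S).PosSemidef := by
  have : 1 + S = (1 / 2 : ℂ) • ((1 + S).conjTranspose * (1 + S)) := by
    rw [Matrix.conjTranspose_add, h.1, Matrix.conjTranspose_one, add_mul, mul_add, mul_add,
      h.2, one_mul, one_mul, mul_one]
    module
  rw [this]
  exact (Matrix.posSemidef_conjTranspose_mul_self _).smul (by norm_num [Complex.le_def])

theorem IsReflection.posSemidef_abs_add {m : Type*} [Fintype m] [DecidableEq m]
    {S : Matrix m m ℂ} (h : IsReflection S) (u : ℝ) :
    (((|u| : ℝ) : ℂ) • (1 : Matrix m m ℂ) + (u : ℂ) • S).PosSemidef := by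
  rcases abs_cases u with ⟨hu, h0⟩ | ⟨hu, h0⟩
  · rw [hu, ← smul_add]
    exact h.posSemidef_one_add.smul (by exact_mod_cast h0)
  · have : ((-u : ℝ) : ℂ) • (1 : Matrix m m ℂ) + (u : ℂ) • S = ((-u : ℝ) : ℂ) • (1 + -S) := by
      push_cast
      module
    rw [hu, this]
    exact h.neg.posSemidef_one_add.smul (by rw [Complex.zero_le_real]; linarith)

theorem IsReflection.posSemidef_one_add_smul_add_smul {m : Type*} [Fintype m] [DecidableEq m]
    {S T : Matrix m m ℂ} (hS : IsReflection S) (hT : IsReflection T) {u v : ℝ}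
    (huv : |u| + |v| ≤ 1) : (1 + (u : ℂ) • S + (v : ℂ) • T).PosSemidef := by
  have : 1 + (u : ℂ) • S + (v : ℂ) • T = ((1 - |u| - |v| : ℝ) : ℂ) • (1 : Matrix m m ℂ) +
      ((((|u| : ℝ) : ℂ) • (1 : Matrix m m ℂ) + (u : ℂ) • S) +
        (((|v| : ℝ) : ℂ) • (1 : Matrix m m ℂ) + (v : ℂ) • T)) := by
    push_cast
    module
  rw [this]
  exact (Matrix.PosSemidef.one.smul (by rw [Complex.zero_le_real]; linarith)).add
    ((hS.posSemidef_abs_add u).add (hT.posSemidef_abs_add v))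

theorem ofReal_inv_sqrt_two_mul_self :
    ((1 / √2 : ℝ) : ℂ) * ((1 / √2 : ℝ) : ℂ) = 1 / 2 := by
  rw [← Complex.ofReal_mul, div_mul_div_comm, Real.mul_self_sqrt (by norm_num)]
  norm_num

/-- The combination of two anticommuting reflections with coefficients `1 / √2`. -/
theorem IsReflection.of_anticommute {m : Type*} [Fintype m] [DecidableEq m]
    {S T : Matrix m m ℂ} (hS : IsReflection S) (hT : IsReflection T) (h : S * T + T * S = 0) :
    IsReflection (((1 / √2 : ℝ) : ℂ) • S + ((1 / √2 : ℝ) : ℂ) • T) := by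
  constructor
  · rw [Matrix.IsHermitian, Matrix.conjTranspose_add, Matrix.conjTranspose_smul,
      Matrix.conjTranspose_smul, hS.1, hT.1, RCLike.star_def, Complex.conj_ofReal]
  · have : (((1 / √2 : ℝ) : ℂ) • S + ((1 / √2 : ℝ) : ℂ) • T) *
        (((1 / √2 : ℝ) : ℂ) • S + ((1 / √2 : ℝ) : ℂ) • T) =
        (((1 / √2 : ℝ) : ℂ) * ((1 / √2 : ℝ) : ℂ)) • (S * S + T * T + (S * T + T * S)) := by
      simp only [add_mul, mul_add, smul_mul_assoc, mul_smul_comm, smul_smul, smul_add]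
      abel
    rw [this, h, ofReal_inv_sqrt_two_mul_self, hS.2, hT.2]
    module

theorem IsReflection.tensor {X : Fin n → Type} [∀ i, Fintype (X i)] [∀ i, DecidableEq (X i)]
    {S : ∀ i, Matrix (X i) (X i) ℂ} (h : ∀ i, IsReflection (S i)) :
    IsReflection (ProcessFramework.tensor S) := by
  constructor
  · rw [Matrix.IsHermitian, tensor_conjTranspose]
    exact congrArg _ (funext fun i => (h i).1)
  · simp only [tensor_mul, (h _).2, tensor_one]

theorem IsReflection.one {m : Type*} [Fintype m] [DecidableEq m] :
    IsReflection (1 : Matrix m m ℂ) := ⟨Matrix.isHermitian_one, one_mul 1⟩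

theorem IsReflection.kronecker {a b : Type*} [Fintype a] [DecidableEq a] [Fintype b]
    [DecidableEq b] {S : Matrix a a ℂ} {T : Matrix b b ℂ} (hS : IsReflection S)
    (hT : IsReflection T) : IsReflection (S ⊗ₖ T) := by
  constructor
  · rw [Matrix.IsHermitian, Matrix.conjTranspose_kronecker, hS.1, hT.1]
  · rw [← Matrix.mul_kronecker_mul, hS.2, hT.2, Matrix.one_kronecker_one]

section TraceBounds

variable {m : Type*} [Fintype m] {S T M : Matrix m m ℂ}

theorem ofReal_re_trace_mul (hS : S.IsHermitian) (hM : M.IsHermitian) :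
    (((S * M).trace.re : ℝ) : ℂ) = (S * M).trace := by
  rw [← Complex.conj_eq_iff_re, ← RCLike.star_def, ← Matrix.trace_conjTranspose,
    Matrix.conjTranspose_mul, hS, hM, Matrix.trace_mul_comm]

variable [DecidableEq m]

theorem IsReflection.re_trace_mul_le (hS : IsReflection S) (hM : M.PosSemidef) :
    -(S * M).trace.re ≤ M.trace.re := by
  have := (Complex.le_def.1 (trace_mul_nonneg hS.posSemidef_one_add hM)).1
  rw [add_mul, one_mul, Matrix.trace_add, Complex.add_re, Complex.zero_re] at this
  linarith

theorem IsReflection.abs_re_trace_mul_le (hS : IsReflection S) (hM : M.PosSemidef) :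
    |(S * M).trace.re| ≤ M.trace.re := by
  have := hS.neg.re_trace_mul_le hM
  rw [neg_mul, Matrix.trace_neg, Complex.neg_re, neg_neg] at this
  exact abs_le'.2 ⟨this, hS.re_trace_mul_le hM⟩

/-- `|x| + |y|` is the larger of `|x + y|` and `|x - y|`. Both are expectations of reflections,
since `-T` anticommutes with `S` as well. This bound makes the process left by any event of Charlie
separable. -/
theorem IsReflection.abs_add_abs_re_trace_mul_le (hS : IsReflection S) (hT : IsReflection T)
    (h : S * T + T * S = 0) (hM : M.PosSemidef) :
    |1 / √2 * (S * M).trace.re| + |1 / √2 * (T * M).trace.re| ≤ M.trace.re := by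
  have key {S T : Matrix m m ℂ} (hS : IsReflection S) (hT : IsReflection T)
      (h : S * T + T * S = 0) :
      |1 / √2 * (S * M).trace.re + 1 / √2 * (T * M).trace.re| ≤ M.trace.re := by
    have := (hS.of_anticommute hT h).abs_re_trace_mul_le hM
    rwa [add_mul, smul_mul_assoc, smul_mul_assoc, Matrix.trace_add, Matrix.trace_smul,
      Matrix.trace_smul, smul_eq_mul, smul_eq_mul, Complex.add_re, Complex.re_ofReal_mul,
      Complex.re_ofReal_mul] at this
  have h1 := key hS hT h
  have h2 := key hS hT.neg (by rw [mul_neg, neg_mul, ← neg_add, h, neg_zero])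
  rw [neg_mul, Matrix.trace_neg, Complex.neg_re, mul_neg] at h2
  rw [abs_le] at h1 h2
  rcases abs_cases (1 / √2 * (S * M).trace.re) with hs | hs <;>
    rcases abs_cases (1 / √2 * (T * M).trace.re) with ht | ht <;> linarith

end TraceBounds

/-! ### Operators with two product terms, and conditioning on one party -/

/-- The operator `d⁻¹ (1 + u ⨂ᵢ Sᵢ + v ⨂ᵢ Tᵢ)`, where `d` is the dimension of the joint input
system. -/
noncomputable def mixOp {n : ℕ} {In Out : Fin n → Type} [∀ i, Fintype (In i)] [∀ i, DecidableEq (In i)]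
    [∀ i, DecidableEq (Out i)] (u v : ℝ)
    (S T : ∀ i, Matrix (In i × Out i) (In i × Out i) ℂ) : POp In Out :=
  ((∏ i, (Fintype.card (In i) : ℂ))⁻¹) •
    (tensor (fun _ => 1) + (u : ℂ) • tensor S + (v : ℂ) • tensor T)

section MixOp

variable {n : ℕ} {In Out : Fin n → Type} [∀ i, Fintype (In i)] [∀ i, DecidableEq (In i)]
  [∀ i, Fintype (Out i)] [∀ i, DecidableEq (Out i)]
  {S T : ∀ i, Matrix (In i × Out i) (In i × Out i) ℂ} {u v : ℝ}

theorem trace_mixOp_mul_tensor (u v : ℝ) (S T M : ∀ i, Matrix (In i × Out i) (In i × Out i) ℂ) :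
    (mixOp u v S T * tensor M).trace = (∏ i, (Fintype.card (In i) : ℂ))⁻¹ *
      (∏ i, (M i).trace + u * ∏ i, (S i * M i).trace + v * ∏ i, (T i * M i).trace) := by
  simp only [mixOp, smul_mul_assoc, add_mul, Matrix.trace_smul, Matrix.trace_add,
    trace_tensor_mul_tensor, one_mul, smul_eq_mul]

theorem trace_eq_card {a b : Type} [Fintype a] [DecidableEq a] [Fintype b]
    {M : Matrix (a × b) (a × b) ℂ} (h : traceOut M = 1) : M.trace = Fintype.card a := by
  rw [← trace_traceOut, h, Matrix.trace_one]

theorem trace_mixOp_mul_tensor_eq_one [∀ i, Nonempty (In i)]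
    (hS : u = 0 ∨ ∃ i, InputTraceless (S i)) (hT : v = 0 ∨ ∃ i, InputTraceless (T i))
    {M : ∀ i, Matrix (In i × Out i) (In i × Out i) ℂ} (hM : ∀ i, traceOut (M i) = 1) :
    (mixOp u v S T * tensor M).trace = 1 := by
  have key {S : ∀ i, Matrix (In i × Out i) (In i × Out i) ℂ} {u : ℝ}
      (hS : u = 0 ∨ ∃ i, InputTraceless (S i)) : (u : ℂ) * ∏ i, (S i * M i).trace = 0 := by
    rcases hS with rfl | ⟨i, hi⟩
    · simp
    · rw [Finset.prod_eq_zero (Finset.mem_univ i) (hi _ (hM i)), mul_zero]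
  rw [trace_mixOp_mul_tensor, key hS, key hT, add_zero, add_zero,
    Finset.prod_congr rfl fun i _ => trace_eq_card (hM i)]
  exact inv_mul_cancel₀ (Finset.prod_ne_zero_iff.2 fun i _ => by
    exact_mod_cast Fintype.card_ne_zero)

theorem isProcessMatrix_mixOp [∀ i, Nonempty (In i)] (hS : ∀ i, IsReflection (S i))
    (hT : ∀ i, IsReflection (T i)) (hS' : u = 0 ∨ ∃ i, InputTraceless (S i))
    (hT' : v = 0 ∨ ∃ i, InputTraceless (T i)) (huv : |u| + |v| ≤ 1) :
    IsProcessMatrix (mixOp u v S T) := by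
  refine ⟨?_, fun M _ hM => trace_mixOp_mul_tensor_eq_one hS' hT' hM⟩
  rw [mixOp, tensor_one]
  refine ((IsReflection.tensor hS).posSemidef_one_add_smul_add_smul
    (IsReflection.tensor hT) huv).smul ?_
  rw [← Nat.cast_prod, ← Complex.ofReal_natCast, ← Complex.ofReal_inv, Complex.zero_le_real]
  positivity

end MixOp

/-- The outcome distribution on a maximally mixed input. It serves as the process of the first party
when a process described by `mixOp` is conditioned. -/
theorem exists_pmf_trace_choi {a b : Type} [Fintype a] [DecidableEq a] [Nonempty a] [Fintype b]
    (t : Instrument a b) : ∃ p : PMF ℕ, ∀ k,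
      ((p k).toReal : ℂ) = (Fintype.card a : ℂ)⁻¹ * (choi (t.map k)).trace := by
  obtain ⟨N, h0, -, htr⟩ := t.sum_choi
  refine exists_pmf _ (fun k => mul_nonneg ?_ (posSemidef_choi (t.isCP k)).trace_nonneg)
    (Finset.range N) ?_ fun k hk => ?_
  · rw [← Complex.ofReal_natCast, ← Complex.ofReal_inv, Complex.zero_le_real]
    positivity
  · rw [← Finset.mul_sum, ← Matrix.trace_sum, trace_eq_card htr]
    exact inv_mul_cancel₀ (by exact_mod_cast Fintype.card_ne_zero)
  · rw [h0 k (by simpa using hk), Matrix.trace_zero, mul_zero]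

section Conditioning

variable {n : ℕ} {In Out : Fin (n + 1) → Type} [∀ i, Fintype (In i)] [∀ i, DecidableEq (In i)]
  [∀ i, Fintype (Out i)] [∀ i, DecidableEq (Out i)] [∀ i, Nonempty (In i)]
  {S T : ∀ i, Matrix (In i × Out i) (In i × Out i) ℂ} {u v : ℝ}

/-- Conditioning the process described by `mixOp u v S T` on the events of party `i`. -/
theorem exists_conditional_of_describes_mixOp (hS : ∀ i, IsReflection (S i))
    (hT : ∀ i, IsReflection (T i)) {P : InstrProcess In Out} (hP : Describes (mixOp u v S T) P)
    (i : Fin (n + 1))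
    (hc : ∀ M : Matrix (In i × Out i) (In i × Out i) ℂ, M.PosSemidef → 0 < M.trace.re →
      ∃ Q : InstrProcess (fun j => In (i.succAbove j)) (fun j => Out (i.succAbove j)),
        Describes (mixOp (u * (S i * M).trace.re / M.trace.re) (v * (T i * M).trace.re / M.trace.re)
          (fun j => S (i.succAbove j)) (fun j => T (i.succAbove j))) Q ∧ IsCausallySeparable Q) :
    ∃ (R : Instrument (In i) (Out i) → PMF ℕ)
      (cond : Instrument (In i) (Out i) → ℕ →
        InstrProcess (fun j => In (i.succAbove j)) (fun j => Out (i.succAbove j))),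
      (∀ s o, P s o = R (s i) (o i) *
        cond (s i) (o i) (fun j => s (i.succAbove j)) (fun j => o (i.succAbove j))) ∧
      ∀ t k, R t k ≠ 0 → IsCausallySeparable (cond t k) := by
  choose R hR using fun t : Instrument (In i) (Out i) => exists_pmf_trace_choi t
  have hpos (t : Instrument (In i) (Out i)) (k) : (choi (t.map k)).PosSemidef :=
    posSemidef_choi (t.isCP k)
  have hre (t : Instrument (In i) (Out i)) (k) :
      (((choi (t.map k)).trace.re : ℝ) : ℂ) = (choi (t.map k)).trace := by
    simpa using ofReal_re_trace_mul Matrix.isHermitian_one (hpos t k).1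
  have hcond (t : Instrument (In i) (Out i)) (k) :
      ∃ Q : InstrProcess (fun j => In (i.succAbove j)) (fun j => Out (i.succAbove j)),
        (choi (t.map k)).trace ≠ 0 → Describes (mixOp
          (u * (S i * choi (t.map k)).trace.re / (choi (t.map k)).trace.re)
          (v * (T i * choi (t.map k)).trace.re / (choi (t.map k)).trace.re)
          (fun j => S (i.succAbove j)) (fun j => T (i.succAbove j))) Q ∧
            IsCausallySeparable Q := by
    by_cases h : (choi (t.map k)).trace = 0
    · exact ⟨fun _ => PMF.pure 0, fun h' => (h' h).elim⟩
    -- A positive operator has real nonnegative trace, so a nonzero trace is positive; for events of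
    -- trace zero the conditional process above is an arbitrary filler.
    · obtain ⟨Q, hQ⟩ := hc _ (hpos t k) (lt_of_le_of_ne
        (Complex.le_def.1 (hpos t k).trace_nonneg).1 fun h0 => h (by rw [← hre, ← h0]; rfl))
      exact ⟨Q, fun _ => hQ⟩
  choose cond hcond using hcond
  refine ⟨R, cond, fun s o => ?_, fun t k h => (hcond t k fun h0 => h ?_).2⟩
  · have : ((P s o).toReal : ℂ) = ((R (s i) (o i) * cond (s i) (o i) (fun j => s (i.succAbove j))
        (fun j => o (i.succAbove j))).toReal : ℂ) := by
      rw [ENNReal.toReal_mul, Complex.ofReal_mul, hR, hP]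
      by_cases h : (choi ((s i).map (o i))).trace = 0
      -- An event of zero trace is the zero operator, so both sides vanish.
      · rw [h, mul_zero, zero_mul, tensor_eq_zero (i := i) ((hpos _ _).trace_eq_zero_iff.1 h),
          mul_zero, Matrix.trace_zero]
      -- Split off the factor of party `i` in every product: its trace over the dimension goes to
      -- `R`, and its relative expectations of `S i` and `T i` rescale `u` and `v`.
      · rw [(hcond _ _ h).1, trace_mixOp_mul_tensor, trace_mixOp_mul_tensor,
          Fin.prod_univ_succAbove _ i, Fin.prod_univ_succAbove _ i, Fin.prod_univ_succAbove _ i,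
          Fin.prod_univ_succAbove _ i]
        push_cast
        rw [ofReal_re_trace_mul (hS i).1 (hpos _ _).1, ofReal_re_trace_mul (hT i).1 (hpos _ _).1,
          hre]
        field_simp
    exact (ENNReal.toReal_eq_toReal_iff' (PMF.apply_ne_top _ _)
      (ENNReal.mul_ne_top (PMF.apply_ne_top _ _) (PMF.apply_ne_top _ _))).1 (by exact_mod_cast this)
  · have := hR t k
    rw [h0, mul_zero, Complex.ofReal_eq_zero, ENNReal.toReal_eq_zero_iff] at this
    exact this.resolve_right (PMF.apply_ne_top _ _)

end Conditioning

theorem IsProcessMatrix.isQuantum {n : ℕ} {In Out : Fin n → Type} [∀ i, Fintype (In i)]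
    [∀ i, DecidableEq (In i)] [∀ i, Fintype (Out i)] {W : POp In Out} {P : InstrProcess In Out}
    (hW : IsProcessMatrix W) (hP : Describes W P) : IsQuantum P :=
  ⟨W, hW, hP⟩

theorem IsQuantum.isCausallySeparable_of_conditional {n : ℕ} {In Out : Fin (n + 1) → Type}
    [∀ i, Fintype (In i)] [∀ i, DecidableEq (In i)] [∀ i, Fintype (Out i)]
    {P : InstrProcess In Out} (hP : IsQuantum P) (q : PMF (Fin (n + 1)))
    (Q : Fin (n + 1) → InstrProcess In Out) (h : ∀ s, P s = q.bind fun i => Q i s)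
    (hQ : ∀ i, IsQuantum (Q i))
    (hc : ∀ i, ∃ (R : Instrument (In i) (Out i) → PMF ℕ)
      (cond : Instrument (In i) (Out i) → ℕ →
        InstrProcess (fun j => In (i.succAbove j)) (fun j => Out (i.succAbove j))),
      (∀ s o, Q i s o = R (s i) (o i) *
        cond (s i) (o i) (fun j => s (i.succAbove j)) (fun j => o (i.succAbove j))) ∧
      ∀ t k, R t k ≠ 0 → IsCausallySeparable (cond t k)) :
    IsCausallySeparable P := by
  rw [IsCausallySeparable]
  exact ⟨hP, q, Q, h, fun i => ⟨hQ i, hc i⟩⟩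

/-! ### Causal separability -/

section MaximallyMixed

variable {n : ℕ} {In Out : Fin n → Type} [∀ i, Fintype (In i)] [∀ i, DecidableEq (In i)]
  [∀ i, Fintype (Out i)] [∀ i, DecidableEq (Out i)] [∀ i, Nonempty (In i)]

theorem isProcessMatrix_mixOp_zero :
    IsProcessMatrix (mixOp (In := In) (Out := Out) 0 0 (fun _ => 1) (fun _ => 1)) :=
  isProcessMatrix_mixOp (fun _ => IsReflection.one) (fun _ => IsReflection.one) (Or.inl rfl)
    (Or.inl rfl) (by rw [abs_zero, add_zero]; exact zero_le_one)

/-- Any party may come first here. This process fills the components of weight zero in mixtures, for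
which the definition still demands a decomposition. -/
theorem isCausallySeparable_of_describes_mixOp_zero {P : InstrProcess In Out}
    (hP : Describes (mixOp 0 0 (fun _ => 1) (fun _ => 1)) P) : IsCausallySeparable P := by
  induction n with
  | zero => rw [IsCausallySeparable]; trivial
  | succ n ih =>
    have hq := isProcessMatrix_mixOp_zero.isQuantum hP
    refine hq.isCausallySeparable_of_conditional (PMF.pure 0) (fun _ => P)
      (fun s => (PMF.pure_bind 0 fun _ => P s).symm) (fun _ => hq) fun i =>
        exists_conditional_of_describes_mixOp (fun _ => IsReflection.one)
          (fun _ => IsReflection.one) hP i fun M _ _ => ?_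
    rw [zero_mul, zero_div]
    obtain ⟨Q, hQ⟩ := (isProcessMatrix_mixOp_zero (In := fun j => In (i.succAbove j))
      (Out := fun j => Out (i.succAbove j))).exists_describes
    exact ⟨Q, hQ, ih hQ⟩

end MaximallyMixed

theorem IsQuantum.isCausallySeparable_of_one_party {In Out : Fin 1 → Type}
    [∀ i, Fintype (In i)] [∀ i, DecidableEq (In i)] [∀ i, Fintype (Out i)]
    {P : InstrProcess In Out} (hP : IsQuantum P) : IsCausallySeparable P := by
  have : Subsingleton (Fin (0 + 1)) := inferInstanceAs (Subsingleton (Fin 1))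
  refine hP.isCausallySeparable_of_conditional (PMF.pure 0) (fun _ => P) (fun s => by simp)
    (fun _ => hP) fun i => ?_
  obtain rfl : i = 0 := Subsingleton.elim _ _
  refine ⟨fun t => (P fun i => Subsingleton.elim 0 i ▸ t).map fun o => o 0,
    fun _ _ _ => PMF.pure default, fun s o => ?_, fun t k _ => ?_⟩
  · beta_reduce
    have hs : (fun i => Subsingleton.elim 0 i ▸ s 0 : ∀ i, Instrument (In i) (Out i)) = s := by
      ext i
      obtain rfl : i = 0 := Subsingleton.elim _ _
      rfl
    rw [hs, PMF.map_apply, tsum_eq_single o]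
    · rw [if_pos rfl, PMF.pure_apply, if_pos (Subsingleton.elim _ _), mul_one]
    · intro o' ho'
      refine if_neg fun h => ho' (funext fun i => ?_)
      obtain rfl : i = 0 := Subsingleton.elim _ _
      exact h.symm
  · rw [IsCausallySeparable]
    trivial

/-- The mixture has weight `1 - |u|` on a process with only the `T` term, where party 0 comes first,
and weight `|u|` on one with only the `S` term, where party 1 comes first. -/
theorem isCausallySeparable_of_describes_mixOp_two {In Out : Fin 2 → Type}
    [∀ i, Fintype (In i)] [∀ i, DecidableEq (In i)] [∀ i, Fintype (Out i)]
    [∀ i, DecidableEq (Out i)] [∀ i, Nonempty (In i)]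
    {S T : ∀ i, Matrix (In i × Out i) (In i × Out i) ℂ} {u v : ℝ}
    (hS : ∀ i, IsReflection (S i)) (hT : ∀ i, IsReflection (T i)) (hS0 : InputTraceless (S 0))
    (hT1 : InputTraceless (T 1)) (huv : |u| + |v| ≤ 1) {P : InstrProcess In Out}
    (hP : Describes (mixOp u v S T) P) : IsCausallySeparable P := by
  have hu0 := abs_nonneg u
  have hv0 := abs_nonneg v
  -- `u'` is the sign of `u`, with `0 / 0 = 0` covering `u = 0`.
  obtain ⟨u', hu, hu'⟩ : ∃ u' : ℝ, |u| * u' = u ∧ |u'| ≤ 1 := by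
    refine ⟨u / |u|, ?_, by rw [abs_div, abs_abs]; exact div_self_le_one _⟩
    rcases eq_or_ne u 0 with rfl | h
    · simp
    · field_simp
  -- If `|u| = 1` then `v = 0`, and division by zero gives `v' = 0`.
  obtain ⟨v', hv, hv'⟩ : ∃ v' : ℝ, (1 - |u|) * v' = v ∧ |v'| ≤ 1 := by
    refine ⟨v / (1 - |u|), ?_, ?_⟩
    · rcases eq_or_ne (1 - |u|) 0 with h | h
      · rw [abs_eq_zero.1 (by linarith : |v| = 0)]
        simp
      · field_simp
    · rw [abs_div, abs_of_nonneg (by linarith : 0 ≤ 1 - |u|)]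
      exact div_le_one_of_le₀ (by linarith) (by linarith)
  have hW0 : IsProcessMatrix (mixOp 0 v' S T) :=
    isProcessMatrix_mixOp hS hT (Or.inl rfl) (Or.inr ⟨1, hT1⟩) (by simpa using hv')
  have hW1 : IsProcessMatrix (mixOp u' 0 S T) :=
    isProcessMatrix_mixOp hS hT (Or.inr ⟨0, hS0⟩) (Or.inl rfl) (by simpa using hu')
  obtain ⟨Q0, hQ0⟩ := hW0.exists_describes
  obtain ⟨Q1, hQ1⟩ := hW1.exists_describes
  obtain ⟨q, hq⟩ := exists_pmf (fun i : Fin 2 => ((![1 - |u|, |u|] i : ℝ) : ℂ))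
    (fun i => by
      rw [Complex.zero_le_real]
      fin_cases i
      · exact (by linarith : 0 ≤ 1 - |u|)
      · exact hu0)
    Finset.univ (by rw [← Complex.ofReal_sum]; simp) (by simp)
  refine ((isProcessMatrix_mixOp hS hT (Or.inr ⟨0, hS0⟩) (Or.inr ⟨1, hT1⟩)
    huv).isQuantum hP).isCausallySeparable_of_conditional q ![Q0, Q1] (fun s => ?_) ?_ ?_
  · ext o
    rw [PMF.bind_apply, tsum_fintype, Fin.sum_univ_two]
    have h0 : ((q 0).toReal : ℂ) = ((1 - |u| : ℝ) : ℂ) := hq 0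
    have h1 : ((q 1).toReal : ℂ) = ((|u| : ℝ) : ℂ) := hq 1
    have hne (i : Fin 2) (Q : InstrProcess In Out) : q i * Q s o ≠ ∞ :=
      ENNReal.mul_ne_top (PMF.apply_ne_top _ _) (PMF.apply_ne_top _ _)
    refine (ENNReal.toReal_eq_toReal_iff' (PMF.apply_ne_top _ _)
      (ENNReal.add_ne_top.2 ⟨hne _ _, hne _ _⟩)).1 ?_
    rw [ENNReal.toReal_add (hne _ _) (hne _ _), ENNReal.toReal_mul, ENNReal.toReal_mul]
    refine Complex.ofReal_injective ?_
    change _ = (((q 0).toReal * (Q0 s o).toReal + (q 1).toReal * (Q1 s o).toReal : ℝ) : ℂ)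
    rw [Complex.ofReal_add, Complex.ofReal_mul, Complex.ofReal_mul, h0, h1, hP, hQ0, hQ1]
    generalize (fun i => choi ((s i).map (o i))) = M
    have hu₁ : ((|u| : ℝ) : ℂ) * u' = u := by exact_mod_cast hu
    have hv₁ : (1 - ((|u| : ℝ) : ℂ)) * v' = v := by exact_mod_cast hv
    rw [trace_mixOp_mul_tensor, trace_mixOp_mul_tensor, trace_mixOp_mul_tensor, ← hv₁,
      Complex.ofReal_sub, Complex.ofReal_one, Complex.ofReal_zero]
    linear_combination
      -((∏ i, (Fintype.card (In i) : ℂ))⁻¹ * ∏ i, (S i * M i).trace) * hu₁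
  · intro i
    fin_cases i
    · exact hW0.isQuantum hQ0
    · exact hW1.isQuantum hQ1
  · intro i
    fin_cases i
    -- Party 0 first: the remaining factor `T 1` is still input traceless, so every event leaves a
    -- process matrix for party 1 alone.
    · refine exists_conditional_of_describes_mixOp hS hT hQ0 0 fun M hM hM0 => ?_
      have hW : IsProcessMatrix (mixOp (0 * (S 0 * M).trace.re / M.trace.re)
          (v' * (T 0 * M).trace.re / M.trace.re) (fun j => S (Fin.succAbove 0 j))
          (fun j => T (Fin.succAbove 0 j))) := by
        refine isProcessMatrix_mixOp (fun j => hS _) (fun j => hT _) (Or.inl (by simp))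
          (Or.inr ⟨0, hT1⟩) ?_
        rw [zero_mul, zero_div, abs_zero, zero_add, abs_div, abs_mul, abs_of_pos hM0]
        exact div_le_one_of_le₀ ((mul_le_of_le_one_left (abs_nonneg _) hv').trans
          ((hT 0).abs_re_trace_mul_le hM)) hM0.le
      obtain ⟨Q, hQ⟩ := hW.exists_describes
      exact ⟨Q, hQ, (hW.isQuantum hQ).isCausallySeparable_of_one_party⟩
    · refine exists_conditional_of_describes_mixOp hS hT hQ1 1 fun M hM hM0 => ?_
      have hW : IsProcessMatrix (mixOp (u' * (S 1 * M).trace.re / M.trace.re)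
          (0 * (T 1 * M).trace.re / M.trace.re) (fun j => S (Fin.succAbove 1 j))
          (fun j => T (Fin.succAbove 1 j))) := by
        refine isProcessMatrix_mixOp (fun j => hS _) (fun j => hT _) (Or.inr ⟨0, hS0⟩)
          (Or.inl (by simp)) ?_
        rw [zero_mul, zero_div, abs_zero, add_zero, abs_div, abs_mul, abs_of_pos hM0]
        exact div_le_one_of_le₀ ((mul_le_of_le_one_left (abs_nonneg _) hu').trans
          ((hS 1).abs_re_trace_mul_le hM)) hM0.le
      obtain ⟨Q, hQ⟩ := hW.exists_describes
      exact ⟨Q, hQ, (hW.isQuantum hQ).isCausallySeparable_of_one_party⟩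

/-- If the operators of the last party anticommute, each of its events leaves behind a causally
separable process of the other two. -/
theorem isCausallySeparable_of_describes_mixOp_three {In Out : Fin 3 → Type}
    [∀ i, Fintype (In i)] [∀ i, DecidableEq (In i)] [∀ i, Fintype (Out i)]
    [∀ i, DecidableEq (Out i)] [∀ i, Nonempty (In i)]
    {S T : ∀ i, Matrix (In i × Out i) (In i × Out i) ℂ}
    (hS : ∀ i, IsReflection (S i)) (hT : ∀ i, IsReflection (T i)) (hS0 : InputTraceless (S 0))
    (hT1 : InputTraceless (T 1)) (hST : S 2 * T 2 + T 2 * S 2 = 0) {P : InstrProcess In Out}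
    (hW : IsProcessMatrix (mixOp (1 / √2) (1 / √2) S T))
    (hP : Describes (mixOp (1 / √2) (1 / √2) S T) P) : IsCausallySeparable P := by
  obtain ⟨Q0, hQ0⟩ := (isProcessMatrix_mixOp_zero (In := In) (Out := Out)).exists_describes
  -- All weight is on party 2 coming first; `Q0` is the filler for the other two components.
  refine (hW.isQuantum hP).isCausallySeparable_of_conditional (PMF.pure 2)
    (fun i => if i = 2 then P else Q0) (fun s => by rw [PMF.pure_bind, if_pos rfl]) (fun i => ?_) fun i => ?_
  · split_ifs
    · exact hW.isQuantum hP
    · exact isProcessMatrix_mixOp_zero.isQuantum hQ0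
  · rcases eq_or_ne i 2 with rfl | hi
    · rw [if_pos rfl]
      refine exists_conditional_of_describes_mixOp hS hT hP 2 fun M hM hM0 => ?_
      have huv : |1 / √2 * (S 2 * M).trace.re / M.trace.re| +
          |1 / √2 * (T 2 * M).trace.re / M.trace.re| ≤ 1 := by
        rw [abs_div, abs_div, abs_of_pos hM0, ← add_div]
        exact div_le_one_of_le₀ ((hS 2).abs_add_abs_re_trace_mul_le (hT 2) hST hM) hM0.le
      obtain ⟨Q, hQ⟩ := (isProcessMatrix_mixOp (S := fun j => S (Fin.succAbove 2 j))
        (T := fun j => T (Fin.succAbove 2 j)) (fun j => hS _) (fun j => hT _)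
        (Or.inr ⟨0, hS0⟩) (Or.inr ⟨1, hT1⟩) huv).exists_describes
      exact ⟨Q, hQ, isCausallySeparable_of_describes_mixOp_two
        (S := fun j => S (Fin.succAbove 2 j)) (T := fun j => T (Fin.succAbove 2 j))
        (fun j => hS _) (fun j => hT _) hS0 hT1 huv hQ⟩
    · rw [if_neg hi]
      refine exists_conditional_of_describes_mixOp (fun _ => IsReflection.one)
        (fun _ => IsReflection.one) hQ0 i fun M hM _ => ?_
      rw [zero_mul, zero_div]
      obtain ⟨Q, hQ⟩ := (isProcessMatrix_mixOp_zero (In := fun j => In (i.succAbove j))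
        (Out := fun j => Out (i.succAbove j))).exists_describes
      exact ⟨Q, hQ, isCausallySeparable_of_describes_mixOp_zero hQ⟩

/-! ### Causally separable processes are causal -/

/-- The order in which `i` precedes all other elements, which are ordered by `κ`. -/
def SPO.cons {n : ℕ} (i : Fin (n + 1)) (κ : SPO (Fin n)) : SPO (Fin (n + 1)) where
  prec a b := (a = i ∧ b ≠ i) ∨ ∃ a' b', i.succAbove a' = a ∧ i.succAbove b' = b ∧ κ.prec a' b'
  irrefl := by
    rintro a (⟨h, h'⟩ | ⟨a', b', rfl, hb, h⟩)
    · exact h' h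
    · obtain rfl := Fin.succAbove_right_injective hb
      exact κ.irrefl _ h
  trans := by
    rintro a b c (⟨ha, hb⟩ | ⟨a', b', rfl, rfl, h⟩) (⟨hb', hc⟩ | ⟨b'', c', hb', rfl, h'⟩)
    · exact (hb hb').elim
    · exact Or.inl ⟨ha, Fin.succAbove_ne _ _⟩
    · exact (Fin.succAbove_ne _ _ hb').elim
    · obtain rfl := Fin.succAbove_right_injective hb'
      exact Or.inr ⟨_, _, rfl, rfl, κ.trans _ _ _ h h'⟩

/-- The restriction of an order along `i.succAbove`. -/
def SPO.removeNth {n : ℕ} (i : Fin (n + 1)) (κ : SPO (Fin (n + 1))) : SPO (Fin n) where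
  prec a b := κ.prec (i.succAbove a) (i.succAbove b)
  irrefl _ := κ.irrefl _
  trans _ _ _ := κ.trans _ _ _

section Cons

variable {n : ℕ} {i : Fin (n + 1)} {κ : SPO (Fin n)}

theorem SPO.cons_prec_succAbove (b : Fin n) : (SPO.cons i κ).prec i (i.succAbove b) :=
  Or.inl ⟨rfl, Fin.succAbove_ne _ _⟩

theorem SPO.not_cons_succAbove_prec (a : Fin n) : ¬ (SPO.cons i κ).prec (i.succAbove a) i := by
  rintro (⟨h, -⟩ | ⟨_, _, -, h, -⟩) <;> exact Fin.succAbove_ne _ _ h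

theorem SPO.cons_succAbove_prec_succAbove (a b : Fin n) :
    (SPO.cons i κ).prec (i.succAbove a) (i.succAbove b) ↔ κ.prec a b := by
  constructor
  · rintro (⟨h, -⟩ | ⟨a', b', ha, hb, h⟩)
    · exact (Fin.succAbove_ne _ _ h).elim
    · obtain rfl := Fin.succAbove_right_injective ha
      obtain rfl := Fin.succAbove_right_injective hb
      exact h
  · exact fun h => Or.inr ⟨a, b, rfl, rfl, h⟩

variable {O : Fin (n + 1) → Type*}

/-- The first party has everyone else in its future, so its only possible event is the sure one,
with `X` empty. -/
theorem mem_pastEvent_cons_self {X : Set (Fin (n + 1))} (hX : i ∉ X) {κ₀ : SPO (Fin (n + 1))}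
    {o₀ o : ∀ j, O j} : (SPO.cons i κ, o) ∈ pastEvent i X κ₀ o₀ ↔ X = ∅ := by
  constructor
  · rintro ⟨-, h, -⟩
    refine Set.eq_empty_of_forall_notMem fun x hx => ?_
    rcases Fin.eq_self_or_eq_succAbove i x with rfl | ⟨x, rfl⟩
    · exact hX hx
    · exact h _ hx (SPO.cons_prec_succAbove _)
  · rintro rfl
    simp [pastEvent, SPO.irrefl]

/-- The event splits into a condition on the first party's outcome and on `κ₀`, free of the random
order, and the corresponding event for the other parties. -/
theorem mem_pastEvent_cons {A : Fin n} {X : Set (Fin (n + 1))} {κ₀ : SPO (Fin (n + 1))}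
    {o₀ : ∀ j, O j} {k : O i} {o : ∀ j, O (i.succAbove j)} :
    (SPO.cons i κ, i.insertNth k o) ∈ pastEvent (i.succAbove A) X κ₀ o₀ ↔
      (i ∈ X → k = o₀ i ∧ ∀ y, i.succAbove y ∈ insert (i.succAbove A) X →
        κ₀.prec i (i.succAbove y) ∧ ¬ κ₀.prec (i.succAbove y) i) ∧
      (κ, o) ∈ pastEvent A (i.succAbove ⁻¹' X) (κ₀.removeNth i) fun j => o₀ (i.succAbove j) := by
  simp only [pastEvent, Set.mem_ofPred_eq, Fin.forall_iff_succAbove i, SPO.irrefl,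
    SPO.cons_prec_succAbove, SPO.not_cons_succAbove_prec, SPO.cons_succAbove_prec_succAbove,
    Set.mem_insert_iff, (Fin.succAbove_ne i _).symm, Fin.succAbove_right_inj, Set.mem_preimage,
    Fin.insertNth_apply_same, Fin.insertNth_apply_succAbove, SPO.removeNth, true_iff, false_iff,
    false_or, iff_self, implies_true, not_false_eq_true, true_and]
  grind

end Cons

theorem toOuterMeasure_eq_zero_or_univ {α : Type*} (p : PMF α) (c : Prop) [Decidable c] :
    p.toOuterMeasure {_e | c} = if c then 1 else 0 := by
  split_ifs with h
  · exact (p.toOuterMeasure_apply_eq_one_iff _).2 fun _ _ => h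
  · simp [h]

/-- The joint distribution draws `i` from `q`, then its outcome `k`, then the order and outcomes of
the others from the causal model of `cond i t k`, and puts `i` first. -/
theorem isCausal_of_mixture {n : ℕ} {S O : Fin (n + 1) → Type*} {P : CondProcess S O}
    (q : PMF (Fin (n + 1))) (Q : Fin (n + 1) → CondProcess S O)
    (hP : ∀ s, P s = q.bind fun i => Q i s) (R : ∀ i, S i → PMF (O i))
    (cond : ∀ i, S i → O i →
      CondProcess (fun j => S (i.succAbove j)) (fun j => O (i.succAbove j)))
    (hQ : ∀ i s o, Q i s o = R i (s i) (o i) *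
      cond i (s i) (o i) (fun j => s (i.succAbove j)) (fun j => o (i.succAbove j)))
    (hc : ∀ i t k, R i t k ≠ 0 → IsCausal (cond i t k)) : IsCausal P := by
  classical
  have hex (i) (t : S i) (k : O i) : ∃ J : (∀ j, S (i.succAbove j)) → PMF (SPO (Fin n) × ∀ j, O (i.succAbove j)),
      (∀ s, (J s).map Prod.snd = cond i t k s) ∧ (R i t k ≠ 0 →
      ∀ (A : Fin n) (X : Set (Fin n)), A ∉ X → ∀ (κ₀ : SPO (Fin n)) o₀ s s',
      (∀ i, i ≠ A → s i = s' i) → (J s).toOuterMeasure (pastEvent A X κ₀ o₀) =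
          (J s').toOuterMeasure (pastEvent A X κ₀ o₀)) := by
    by_cases h : R i t k = 0
    -- Events of probability zero carry no causal model, so the empty order is used.
    · refine ⟨fun s => (cond i t k s).map fun o => (⟨fun _ _ => False, by simp, by simp⟩, o),
        fun s => ?_, fun h' => (h' h).elim⟩
      rw [PMF.map_comp]
      exact PMF.map_id _
    · obtain ⟨J, h1, h2⟩ := hc i t k h
      exact ⟨J, h1, fun _ => h2⟩
  choose J hJ hJ' using hex
  refine ⟨fun s => q.bind fun i => (R i (s i)).bind fun k =>
    (J i (s i) k fun j => s (i.succAbove j)).map fun e => (SPO.cons i e.1, i.insertNth k e.2),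
    fun s => ?_, fun A X hA κ₀ o₀ s s' hs => ?_⟩
  · rw [hP, PMF.map_bind]
    congr 1
    ext i o
    have hmap (k) : ((J i (s i) k fun j => s (i.succAbove j)).map fun e =>
        (SPO.cons i e.1, i.insertNth k e.2)).map Prod.snd =
        (cond i (s i) k fun j => s (i.succAbove j)).map fun o => i.insertNth k o := by
      rw [← hJ, PMF.map_comp, PMF.map_comp]
      rfl
    simp only [PMF.map_bind, hmap]
    rw [PMF.bind_apply, tsum_eq_single (o i), hQ, PMF.map_apply,
      tsum_eq_single fun j => o (i.succAbove j), if_pos]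
    · exact Fin.eq_insertNth_iff.2 ⟨rfl, rfl⟩
    · exact fun o' ho' => if_neg fun h => ho' (Fin.eq_insertNth_iff.1 h).2.symm
    · intro k hk
      rw [PMF.map_apply, ENNReal.tsum_eq_zero.2, mul_zero]
      exact fun o' => if_neg fun h => hk (Fin.eq_insertNth_iff.1 h).1.symm
  · rw [PMF.toOuterMeasure_bind_apply, PMF.toOuterMeasure_bind_apply]
    refine tsum_congr fun i => congrArg _ ?_
    rw [PMF.toOuterMeasure_bind_apply, PMF.toOuterMeasure_bind_apply]
    simp only [PMF.toOuterMeasure_map_apply, Set.preimage]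
    -- If `A` comes first, the event is sure or impossible. Otherwise the first party's setting is
    -- unchanged, and independence holds in each conditional model.
    rcases Fin.eq_self_or_eq_succAbove i A with rfl | ⟨A, rfl⟩
    · simp only [mem_pastEvent_cons_self hA, toOuterMeasure_eq_zero_or_univ,
        ENNReal.tsum_mul_right, PMF.tsum_coe]
    · rw [hs i (Fin.succAbove_ne i A).symm]
      refine tsum_congr fun k => ?_
      by_cases h : R i (s' i) k = 0
      · rw [h, zero_mul, zero_mul]
      · congr 1
        simp only [mem_pastEvent_cons]
        by_cases hC : i ∈ X → k = o₀ i ∧ ∀ y, i.succAbove y ∈ insert (i.succAbove A) X →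
            κ₀.prec i (i.succAbove y) ∧ ¬ κ₀.prec (i.succAbove y) i
        · simp only [and_iff_right hC]
          exact hJ' _ _ _ h A _ hA _ _ _ _ fun j hj =>
            hs _ fun h => hj (Fin.succAbove_right_injective h)
        · simp only [hC, false_and, Set.ofPred_false, MeasureTheory.measure_empty]

theorem IsCausallySeparable.isCausal {n : ℕ} {In Out : Fin n → Type} [∀ i, Fintype (In i)]
    [∀ i, DecidableEq (In i)] [∀ i, Fintype (Out i)] {P : InstrProcess In Out}
    (hP : IsCausallySeparable P) : IsCausal P := by
  induction n with
  | zero =>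
    exact ⟨fun s => (P s).map fun o => (⟨fun _ _ => False, by simp, by simp⟩, o),
      fun s => by rw [PMF.map_comp]; exact PMF.map_id _, fun A => A.elim0⟩
  | succ n ih =>
    rw [IsCausallySeparable] at hP
    obtain ⟨-, q, Q, hP, h⟩ := hP
    choose _ R cond hQ hc using h
    exact isCausal_of_mixture q Q hP R cond hQ fun i t k h => ih (hc i t k h)

/-! ### The OCB inequality -/

section PMF

variable {α : Type*} (p : PMF α)

theorem toOuterMeasure_eq_tsum_inter {β : Type*} (f : α → β) (E : Set α) :
    p.toOuterMeasure E = ∑' b, p.toOuterMeasure {e | e ∈ E ∧ f e = b} := by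
  simp only [PMF.toOuterMeasure_apply]
  rw [ENNReal.tsum_comm]
  refine tsum_congr fun x => ?_
  rw [tsum_eq_single (f x)]
  · by_cases h : x ∈ E <;> simp [h]
  · intro b hb
    exact Set.indicator_of_notMem (fun h => hb h.2.symm) _

theorem toOuterMeasure_eq_add (E F : Set α) :
    p.toOuterMeasure E = p.toOuterMeasure (E ∩ F) + p.toOuterMeasure (E ∩ Fᶜ) := by
  simp only [PMF.toOuterMeasure_apply]
  rw [← ENNReal.tsum_add]
  refine tsum_congr fun x => ?_
  by_cases h : x ∈ E <;> by_cases h' : x ∈ F <;> simp [h, h']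

/-- The probability of an event. -/
noncomputable def prob (E : Set α) : ℝ := (p.toOuterMeasure E).toReal

theorem toOuterMeasure_ne_top (E : Set α) : p.toOuterMeasure E ≠ ∞ := by
  have h : p.toOuterMeasure Set.univ = 1 :=
    (p.toOuterMeasure_apply_eq_one_iff _).2 (Set.subset_univ _)
  exact ((p.toOuterMeasure.mono (Set.subset_univ E)).trans_lt
    (h.trans_lt ENNReal.one_lt_top)).ne

theorem prob_nonneg (E : Set α) : 0 ≤ prob p E := ENNReal.toReal_nonneg

theorem prob_univ : prob p Set.univ = 1 := by
  rw [prob, (p.toOuterMeasure_apply_eq_one_iff _).2 (Set.subset_univ _), ENNReal.toReal_one]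

theorem prob_mono {E F : Set α} (h : E ⊆ F) : prob p E ≤ prob p F :=
  ENNReal.toReal_mono (toOuterMeasure_ne_top p F) (p.toOuterMeasure.mono h)

theorem prob_eq_add (E F : Set α) : prob p E = prob p (E ∩ F) + prob p (E ∩ Fᶜ) := by
  rw [prob, toOuterMeasure_eq_add p E F, ENNReal.toReal_add (toOuterMeasure_ne_top _ _)
    (toOuterMeasure_ne_top _ _)]
  rfl

theorem prob_map {β : Type*} (f : α → β) (E : Set β) : prob (p.map f) E = prob p (f ⁻¹' E) := by
  rw [prob, PMF.toOuterMeasure_map_apply, prob]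

end PMF

section NoSignalling

variable {ι : Type*} {S : ι → Type*}

/-- The event that `B` does not follow `A`. -/
def notAfter {O : ι → Type*} (A B : ι) : Set (SPO ι × (∀ i, O i)) := {e | ¬ e.1.prec A B}

/-- The condition in the definition of causal processes. -/
def NoSignalling {O : ι → Type*} (J : (∀ i, S i) → PMF (SPO ι × (∀ i, O i))) : Prop :=
  ∀ (A : ι) (X : Set ι), A ∉ X → ∀ (κ₀ : SPO ι) (o₀ : ∀ i, O i) (s s' : ∀ i, S i),
    (∀ i, i ≠ A → s i = s' i) →
      (J s).toOuterMeasure (pastEvent A X κ₀ o₀) = (J s').toOuterMeasure (pastEvent A X κ₀ o₀)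

variable {J : (∀ i, S i) → PMF (SPO ι × (ι → ℕ))}

theorem NoSignalling.toOuterMeasure_order_outcome (hJ : NoSignalling J) {A B : ι} (hAB : A ≠ B)
    (r : Prop) (k : ℕ) {s s' : ∀ i, S i} (h : ∀ i, i ≠ A → s i = s' i) :
    (J s).toOuterMeasure {e | (e ∈ notAfter A B ∧ (e.1.prec B A ↔ r)) ∧ e.2 B = k} =
      (J s').toOuterMeasure {e | (e ∈ notAfter A B ∧ (e.1.prec B A ↔ r)) ∧ e.2 B = k} := by
  -- Once `B` is not after `A`, the order on `{A, B}` is decided by whether `B` precedes `A`; `r`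
  -- makes one `κ₀` cover both cases.
  have : {e : SPO ι × (ι → ℕ) | (e ∈ notAfter A B ∧ (e.1.prec B A ↔ r)) ∧ e.2 B = k} =
      pastEvent A {B} ⟨fun a b => a = B ∧ b = A ∧ r, by grind, by grind⟩ fun _ => k := by
    ext e
    have h1 := e.1.irrefl A
    have h2 := e.1.irrefl B
    have h3 := e.1.trans A B A
    simp only [notAfter, pastEvent, Set.mem_insert_iff, Set.mem_singleton_iff, forall_eq_or_imp,
      forall_eq, Set.mem_ofPred_eq]
    grind
  rw [this]
  exact hJ A {B} (by simpa using hAB) _ _ s s' h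

theorem NoSignalling.toOuterMeasure_order (hJ : NoSignalling J) {A B : ι} (hAB : A ≠ B)
    (r : Prop) {s s' : ∀ i, S i} (h : ∀ i, i ≠ A → s i = s' i) :
    (J s).toOuterMeasure {e | e ∈ notAfter A B ∧ (e.1.prec B A ↔ r)} =
      (J s').toOuterMeasure {e | e ∈ notAfter A B ∧ (e.1.prec B A ↔ r)} := by
  rw [toOuterMeasure_eq_tsum_inter _ (fun e : SPO ι × (ι → ℕ) => e.2 B),
    toOuterMeasure_eq_tsum_inter _ (fun e : SPO ι × (ι → ℕ) => e.2 B)]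
  exact tsum_congr fun k => hJ.toOuterMeasure_order_outcome hAB r k h

theorem NoSignalling.prob_unordered (hJ : NoSignalling J) {A B : ι} (hAB : A ≠ B)
    {s s' : ∀ i, S i} (h : ∀ i, i ≠ A → s i = s' i) :
    prob (J s) (notAfter A B ∩ notAfter B A) = prob (J s') (notAfter A B ∩ notAfter B A) := by
  have := hJ.toOuterMeasure_order hAB False h
  simp only [iff_false] at this
  exact congrArg ENNReal.toReal this

theorem NoSignalling.prob_notAfter (hJ : NoSignalling J) {A B : ι} (hAB : A ≠ B)
    {s s' : ∀ i, S i} (h : ∀ i, i ≠ A → s i = s' i) :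
    prob (J s) (notAfter A B) = prob (J s') (notAfter A B) := by
  have h1 : (notAfter A B ∩ (notAfter B A)ᶜ : Set (SPO ι × (ι → ℕ))) =
      {e | e ∈ notAfter A B ∧ (e.1.prec B A ↔ True)} := by
    ext e
    simp [notAfter]
  rw [prob_eq_add _ _ (notAfter B A), prob_eq_add (J s') _ (notAfter B A),
    hJ.prob_unordered hAB h, h1]
  exact congrArg _ (congrArg ENNReal.toReal (hJ.toOuterMeasure_order hAB True h))

theorem NoSignalling.prob_notAfter_outcome (hJ : NoSignalling J) {A B : ι} (hAB : A ≠ B) (k : ℕ)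
    {s s' : ∀ i, S i} (h : ∀ i, i ≠ A → s i = s' i) :
    prob (J s) (notAfter A B ∩ {e | e.2 B = k}) =
      prob (J s') (notAfter A B ∩ {e | e.2 B = k}) := by
  have h1 : (notAfter A B ∩ {e | e.2 B = k} ∩ notAfter B A : Set (SPO ι × (ι → ℕ))) =
      {e | (e ∈ notAfter A B ∧ (e.1.prec B A ↔ False)) ∧ e.2 B = k} := by
    ext e
    simp [notAfter, and_right_comm]
  have h2 : (notAfter A B ∩ {e | e.2 B = k} ∩ (notAfter B A)ᶜ : Set (SPO ι × (ι → ℕ))) =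
      {e | (e ∈ notAfter A B ∧ (e.1.prec B A ↔ True)) ∧ e.2 B = k} := by
    ext e
    simp [notAfter, and_right_comm]
  rw [prob_eq_add _ _ (notAfter B A), prob_eq_add (J s') _ (notAfter B A), h1, h2]
  exact congrArg₂ _ (congrArg ENNReal.toReal (hJ.toOuterMeasure_order_outcome hAB False k h))
    (congrArg ENNReal.toReal (hJ.toOuterMeasure_order_outcome hAB True k h))

end NoSignalling

/-- Where `B` follows `A` the outcome may depend on everything, so that part is bounded by its full
probability. -/
theorem prob_outcome_le {ι : Type*} (p : PMF (SPO ι × (ι → ℕ))) (A B : ι) (k : ℕ) :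
    prob p {e | e.2 B = k} ≤
      1 - prob p (notAfter A B) + prob p (notAfter A B ∩ {e | e.2 B = k}) := by
  have h1 := prob_eq_add p {e | e.2 B = k} (notAfter A B)
  have h2 := prob_eq_add p Set.univ (notAfter A B)
  have h3 := prob_mono p (Set.inter_subset_inter_left (notAfter A B)ᶜ
    (Set.subset_univ {e : SPO ι × (ι → ℕ) | e.2 B = k}))
  rw [prob_univ, Set.univ_inter] at h2
  rw [Set.inter_comm] at h1
  linarith

theorem prob_notAfter_outcome_add_le {ι : Type*} (p : PMF (SPO ι × (ι → ℕ))) (A B : ι) :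
    prob p (notAfter A B ∩ {e | e.2 B = ((0 : Fin 2) : ℕ)}) +
      prob p (notAfter A B ∩ {e | e.2 B = ((1 : Fin 2) : ℕ)}) ≤ prob p (notAfter A B) := by
  rw [prob_eq_add p (notAfter A B) {e | e.2 B = ((0 : Fin 2) : ℕ)}]
  refine add_le_add_right (prob_mono p fun e he => And.intro he.1 fun h => ?_) _
  have h1 : e.2 B = 1 := he.2
  have h0 : e.2 B = 0 := h
  omega

/-- Inclusion-exclusion: by antisymmetry at least one of the two events always occurs. -/
theorem prob_notAfter_add {ι : Type*} (p : PMF (SPO ι × (ι → ℕ))) (A B : ι) :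
    prob p (notAfter A B) + prob p (notAfter B A) =
      1 + prob p (notAfter A B ∩ notAfter B A) := by
  have h1 := prob_eq_add p Set.univ (notAfter A B)
  have h2 := prob_eq_add p (notAfter B A) (notAfter A B)
  have h3 : notAfter B A ∩ (notAfter A B)ᶜ = (notAfter A B : Set (SPO ι × (ι → ℕ)))ᶜ := by
    refine Set.inter_eq_right.2 fun e he h => ?_
    exact e.1.irrefl _ (e.1.trans _ _ _ h (not_not.1 he))
  rw [prob_univ, Set.univ_inter, Set.univ_inter] at h1
  rw [h3, Set.inter_comm] at h2
  linarith

/-- The causal inequality of Oreshkov, Costa and Brukner. -/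
theorem IsCausal.ocbSuccess_le {ι : Type*} [DecidableEq ι] {S : ι → Type*}
    {P : CondProcess S (fun _ => ℕ)} (hP : IsCausal P) {A B : ι} (hAB : A ≠ B) (s₀ : ∀ i, S i)
    (α : Fin 2 → S A) (β : Fin 2 → Fin 2 → S B) : ocbSuccess P A B s₀ α β ≤ 3 / 4 := by
  obtain ⟨J, hJP, hJ⟩ := hP
  replace hJ : NoSignalling J := hJ
  set s : Fin 2 → Fin 2 → Fin 2 → ∀ i, S i := fun a b c =>
    Function.update (Function.update s₀ A (α a)) B (β b c) with hs
  have hA (a b c) : ∀ i, i ≠ A → s a b c i = s 0 b c i := fun i hi => by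
    rcases eq_or_ne i B with rfl | hB
    · simp [hs]
    · simp [hs, hi, hB]
  have hB (a b c) : ∀ i, i ≠ B → s a b c i = s a 0 0 i := fun i hi => by simp [hs, hi]
  have hout (C : ι) (k : ℕ) (t) : ((P t).toOuterMeasure {o | o C = k}).toReal =
      prob (J t) {e | e.2 C = k} := by
    rw [← hJP, ← prob, prob_map]
    rfl
  have hU (a b c) : prob (J (s a b c)) (notAfter A B ∩ notAfter B A) =
      prob (J (s 0 0 0)) (notAfter A B ∩ notAfter B A) := by
    rw [hJ.prob_unordered hAB (hA a b c), Set.inter_comm, hJ.prob_unordered hAB.symm (hB 0 b c)]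
  -- Independence of `A`'s setting is direct. For `B`'s setting, `prob_notAfter_add` expresses this
  -- probability through two others that `B` cannot influence.
  have hNA (a b c) : prob (J (s a b c)) (notAfter A B) = prob (J (s 0 0 0)) (notAfter A B) := by
    have h1 := prob_notAfter_add (J (s a b c)) A B
    have h2 := prob_notAfter_add (J (s a 0 0)) A B
    rw [hJ.prob_notAfter hAB.symm (hB a b c), hU] at h1
    rw [hU] at h2
    rw [← hJ.prob_notAfter hAB (hA a 0 0)]
    linarith
  have hNB (a b c) : prob (J (s a b c)) (notAfter B A) = prob (J (s 0 0 0)) (notAfter B A) := by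
    have h1 := prob_notAfter_add (J (s a b c)) A B
    have h2 := prob_notAfter_add (J (s 0 0 0)) A B
    rw [hU, hNA] at h1
    linarith
  have hx (a b : Fin 2) : ((P (s a b 0)).toOuterMeasure {o | o A = (b : ℕ)}).toReal ≤
      1 - prob (J (s 0 0 0)) (notAfter B A) +
        prob (J (s a 0 0)) (notAfter B A ∩ {e | e.2 A = (b : ℕ)}) := by
    rw [hout, ← hNB a b 0, ← hJ.prob_notAfter_outcome hAB.symm b (hB a b 0)]
    exact prob_outcome_le _ _ _ _
  have hy (a b : Fin 2) : ((P (s a b 1)).toOuterMeasure {o | o B = (a : ℕ)}).toReal ≤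
      1 - prob (J (s 0 0 0)) (notAfter A B) +
        prob (J (s 0 b 1)) (notAfter A B ∩ {e | e.2 B = (a : ℕ)}) := by
    rw [hout, ← hNA a b 1, ← hJ.prob_notAfter_outcome hAB a (hA a b 1)]
    exact prob_outcome_le _ _ _ _
  have hx' (a : Fin 2) := prob_notAfter_outcome_add_le (J (s a 0 0)) B A
  have hy' (b : Fin 2) := prob_notAfter_outcome_add_le (J (s 0 b 1)) A B
  simp only [hNA, hNB] at hx' hy'
  have hsum := prob_notAfter_add (J (s 0 0 0)) A B
  have hU0 := prob_nonneg (J (s 0 0 0)) (notAfter A B ∩ notAfter B A)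
  change 1 / 2 * (1 / 4 * ∑ a, ∑ b : Fin 2,
      ((P (s a b 0)).toOuterMeasure {o | o A = (b : ℕ)}).toReal + 1 / 4 * ∑ a : Fin 2, ∑ b,
      ((P (s a b 1)).toOuterMeasure {o | o B = (a : ℕ)}).toReal) ≤ 3 / 4
  simp only [Fin.sum_univ_two]
  -- With `p` and `q` the probabilities of `notAfter B A` and `notAfter A B`, the averaged guesses
  -- are at most `1 - p / 2` and `1 - q / 2`, and `p + q ≥ 1`.
  linarith [hx 0 0, hx 0 1, hx 1 0, hx 1 1, hy 0 0, hy 0 1, hy 1 0, hy 1 1, hx' 0, hx' 1, hy' 0,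
    hy' 1]

/-! ### Ancillary input systems -/

section Extend

variable {n : ℕ} {In Out Anc : Fin n → Type}

theorem extend_tensor_kronecker (D : ∀ i, Matrix (In i) (In i) ℂ)
    (F : ∀ i, Matrix (Out i) (Out i) ℂ) (r : ∀ i, Matrix (Anc i) (Anc i) ℂ) :
    extend (tensor fun i => D i ⊗ₖ F i) (tensor r) =
      tensor fun i => (D i ⊗ₖ r i) ⊗ₖ F i := by
  ext x y
  simp only [extend, tensor, Matrix.of_apply, Matrix.kroneckerMap_apply,
    ← Finset.prod_mul_distrib]
  exact Finset.prod_congr rfl fun i _ => by ring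

theorem posSemidef_extend [∀ i, Finite (In i)] [∀ i, Finite (Out i)] [∀ i, Finite (Anc i)]
    {W : POp In Out} {ρ : Matrix (∀ i, Anc i) (∀ i, Anc i) ℂ} (hW : W.PosSemidef)
    (hρ : ρ.PosSemidef) : (extend W ρ).PosSemidef :=
  (hW.kronecker hρ).submatrix fun x : ∀ i, (In i × Anc i) × Out i =>
    (fun i => ((x i).1.1, (x i).2), fun i => (x i).1.2)

theorem extend_add_left (V W : POp In Out) (ρ : Matrix (∀ i, Anc i) (∀ i, Anc i) ℂ) :
    extend (V + W) ρ = extend V ρ + extend W ρ := by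
  ext x y
  simp [extend, add_mul]

theorem extend_smul_left (c : ℂ) (W : POp In Out) (ρ : Matrix (∀ i, Anc i) (∀ i, Anc i) ℂ) :
    extend (c • W) ρ = c • extend W ρ := by
  ext x y
  simp [extend, mul_assoc]

theorem extend_smul_right (c : ℂ) (W : POp In Out) (ρ : Matrix (∀ i, Anc i) (∀ i, Anc i) ℂ) :
    extend W (c • ρ) = c • extend W ρ := by
  ext x y
  simp [extend, mul_left_comm]

theorem extend_sum_right {α : Type*} (s : Finset α) (W : POp In Out)
    (ρ : α → Matrix (∀ i, Anc i) (∀ i, Anc i) ℂ) :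
    extend W (∑ k ∈ s, ρ k) = ∑ k ∈ s, extend W (ρ k) := by
  ext x y
  simp [extend, Matrix.sum_apply, Finset.mul_sum]

end Extend

/-! ### Commuting and anticommuting tensor products -/

section Commutation

variable {a b : Type*} [Fintype a] [Fintype b] {S S' : Matrix a a ℂ} {T T' : Matrix b b ℂ}

theorem kronecker_commute (h : Commute S S') (h' : Commute T T') :
    Commute (S ⊗ₖ T) (S' ⊗ₖ T') := by
  rw [Commute, SemiconjBy, ← Matrix.mul_kronecker_mul, ← Matrix.mul_kronecker_mul, h.eq, h'.eq]

theorem kronecker_anticommute (h : Commute S S') (h' : T * T' = -(T' * T)) :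
    (S ⊗ₖ T) * (S' ⊗ₖ T') + (S' ⊗ₖ T') * (S ⊗ₖ T) = 0 := by
  rw [← Matrix.mul_kronecker_mul, ← Matrix.mul_kronecker_mul, h.eq, h', ← Matrix.kronecker_add,
    neg_add_cancel, Matrix.kronecker_zero]

theorem tensor_anticommute {n : ℕ} {X : Fin n → Type} [∀ i, Fintype (X i)]
    {S T : ∀ i, Matrix (X i) (X i) ℂ} (i : Fin n) (hi : S i * T i + T i * S i = 0)
    (h : ∀ j, j ≠ i → Commute (S j) (T j)) :
    tensor S * tensor T + tensor T * tensor S = 0 := by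
  rw [tensor_mul, tensor_mul]
  ext x y
  have h1 : ∏ j ∈ Finset.univ.erase i, (S j * T j) (x j) (y j) =
      ∏ j ∈ Finset.univ.erase i, (T j * S j) (x j) (y j) :=
    Finset.prod_congr rfl fun j hj => by rw [(h j (Finset.ne_of_mem_erase hj)).eq]
  have h2 := congrFun (congrFun hi (x i)) (y i)
  rw [Matrix.add_apply] at h2
  simp only [tensor, Matrix.add_apply, Matrix.of_apply]
  rw [← Finset.mul_prod_erase _ _ (Finset.mem_univ i),
    ← Finset.mul_prod_erase (a := i) _ (fun j => (T j * S j) (x j) (y j)) (Finset.mem_univ i),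
    h1, ← add_mul, h2, Matrix.zero_apply, zero_mul, Matrix.zero_apply]

end Commutation

/-! ### The process matrix of the example and its extension -/

section Example

/-- The factors of `σz^{A₁} σz^{B₁}` on the input systems. -/
def sIn : ∀ i : Fin 3, Matrix (Inp i) (Inp i) ℂ
  | 0 => σz
  | 1 => σz
  | 2 => 1

/-- The factors of `σz^{B₂} σx^{C₂}` on the output systems. -/
def sOut : ∀ i : Fin 3, Matrix (Outp i) (Outp i) ℂ
  | 0 => 1
  | 1 => σz
  | 2 => σx

/-- The factors of `σz^{B₁}` on the input systems. -/
def tIn : ∀ i : Fin 3, Matrix (Inp i) (Inp i) ℂ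
  | 0 => 1
  | 1 => σz
  | 2 => 1

/-- The factors of `σz^{A₂} σz^{C₂}` on the output systems. -/
def tOut : ∀ i : Fin 3, Matrix (Outp i) (Outp i) ℂ
  | 0 => σz
  | 1 => 1
  | 2 => σz

/-- The factors of `|kk⟩⟨ll|` on the ancillas. -/
def ancUnit (k l : Fin 2) : ∀ i : Fin 3, Matrix (Ancil i) (Ancil i) ℂ
  | 0 => 1
  | 1 => Matrix.single k l 1
  | 2 => Matrix.single k l 1

theorem isReflection_σx : IsReflection σx := by
  constructor <;> ext i j <;> fin_cases i <;> fin_cases j <;> simp [σx]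

theorem isReflection_σz : IsReflection σz := by
  constructor <;> ext i j <;> fin_cases i <;> fin_cases j <;> simp [σz]

theorem trace_σz : σz.trace = 0 := by simp [σz, Matrix.trace_fin_two]

theorem isReflection_sIn : ∀ i, IsReflection (sIn i)
  | 0 => isReflection_σz
  | 1 => isReflection_σz
  | 2 => IsReflection.one

theorem isReflection_sOut : ∀ i, IsReflection (sOut i)
  | 0 => IsReflection.one
  | 1 => isReflection_σz
  | 2 => isReflection_σx

theorem isReflection_tIn : ∀ i, IsReflection (tIn i)
  | 0 => IsReflection.one
  | 1 => isReflection_σz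
  | 2 => IsReflection.one

theorem isReflection_tOut : ∀ i, IsReflection (tOut i)
  | 0 => isReflection_σz
  | 1 => IsReflection.one
  | 2 => isReflection_σz

theorem prod_card_inp : ∏ i, (Fintype.card (Inp i) : ℂ) = 4 := by
  rw [Fin.prod_univ_three]
  change (Fintype.card (Fin 2) : ℂ) * Fintype.card (Fin 2) * Fintype.card (Fin 1) = 4
  norm_num [Fintype.card_fin]

instance nonempty_inp : ∀ i, Nonempty (Inp i)
  | 0 => ⟨(0 : Fin 2)⟩
  | 1 => ⟨(0 : Fin 2)⟩
  | 2 => ⟨(0 : Fin 1)⟩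

theorem WABC_eq_smul : WABC = (1 / 4 : ℂ) • (tensor (fun _ => 1 ⊗ₖ 1) +
    ((1 / √2 : ℝ) : ℂ) • tensor (fun i => sIn i ⊗ₖ sOut i) +
    ((1 / √2 : ℝ) : ℂ) • tensor fun i => tIn i ⊗ₖ tOut i) := by
  have hS : prodOp (σz ⊗ₖ 1) (σz ⊗ₖ σz) (1 ⊗ₖ σx) = tensor fun i => sIn i ⊗ₖ sOut i := by
    refine congrArg tensor (funext fun i => ?_)
    match i with
    | 0 => rfl
    | 1 => rfl
    | 2 => rfl
  have hT : prodOp (1 ⊗ₖ σz) (σz ⊗ₖ 1) (1 ⊗ₖ σz) = tensor fun i => tIn i ⊗ₖ tOut i := by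
    refine congrArg tensor (funext fun i => ?_)
    match i with
    | 0 => rfl
    | 1 => rfl
    | 2 => rfl
  simp only [Matrix.one_kronecker_one]
  rw [WABC, hS, hT, tensor_one]

theorem WABC_eq_mixOp : WABC = mixOp (1 / √2) (1 / √2) (fun i => sIn i ⊗ₖ sOut i)
    fun i => tIn i ⊗ₖ tOut i := by
  rw [WABC_eq_smul, mixOp, prod_card_inp, one_div]
  simp only [Matrix.one_kronecker_one]

theorem anticommute_charlie : (sIn 2 ⊗ₖ sOut 2) * (tIn 2 ⊗ₖ tOut 2) +
    (tIn 2 ⊗ₖ tOut 2) * (sIn 2 ⊗ₖ sOut 2) = 0 := by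
  refine kronecker_anticommute (Commute.refl _) ?_
  change σx * σz = -(σz * σx)
  ext i j
  fin_cases i <;> fin_cases j <;> simp [σx, σz]

theorem commute_of_ne_charlie : ∀ i, i ≠ 2 →
    Commute (sIn i ⊗ₖ sOut i) (tIn i ⊗ₖ tOut i)
  | 0, _ => kronecker_commute (Commute.one_right _) (Commute.one_left _)
  | 1, _ => kronecker_commute (Commute.refl _) (Commute.one_right _)
  | 2, h => (h rfl).elim

theorem inputTraceless_s : InputTraceless (sIn 0 ⊗ₖ sOut 0) :=
  inputTraceless_kronecker_one trace_σz

theorem inputTraceless_t : InputTraceless (tIn 1 ⊗ₖ tOut 1) :=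
  inputTraceless_kronecker_one trace_σz

theorem exists_inputTraceless_s : ∃ i, InputTraceless (sIn i ⊗ₖ sOut i) :=
  ⟨0, inputTraceless_s⟩

theorem exists_inputTraceless_t : ∃ i, InputTraceless (tIn i ⊗ₖ tOut i) :=
  ⟨1, inputTraceless_t⟩

/-- The coefficients add up to √2 > 1, so `isProcessMatrix_mixOp` does not apply; positivity relies
on the anticommutation at Charlie. -/
theorem isProcessMatrix_WABC : IsProcessMatrix WABC := by
  refine ⟨?_, fun M _ hM => ?_⟩
  · rw [WABC_eq_smul]
    simp only [Matrix.one_kronecker_one, tensor_one]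
    have hS := IsReflection.tensor fun i => (isReflection_sIn i).kronecker (isReflection_sOut i)
    have hT := IsReflection.tensor fun i => (isReflection_tIn i).kronecker (isReflection_tOut i)
    rw [add_assoc]
    exact (hS.of_anticommute hT (tensor_anticommute 2 anticommute_charlie
      commute_of_ne_charlie)).posSemidef_one_add.smul (by norm_num [Complex.le_def])
  · rw [WABC_eq_mixOp]
    exact trace_mixOp_mul_tensor_eq_one (Or.inr exists_inputTraceless_s)
      (Or.inr exists_inputTraceless_t) hM

theorem exists_describes_WABC : ∃ P : InstrProcess Inp Outp, Describes WABC P ∧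
    IsCausallySeparable P ∧ IsCausal P := by
  obtain ⟨P, hP⟩ := isProcessMatrix_WABC.exists_describes
  have : IsCausallySeparable P := isCausallySeparable_of_describes_mixOp_three
    (fun i => (isReflection_sIn i).kronecker (isReflection_sOut i))
    (fun i => (isReflection_tIn i).kronecker (isReflection_tOut i))
    inputTraceless_s inputTraceless_t anticommute_charlie
    (WABC_eq_mixOp ▸ isProcessMatrix_WABC) (WABC_eq_mixOp ▸ hP)
  exact ⟨P, hP, this, this.isCausal⟩

theorem sum_single_mul_single (a b c d : Fin 2) :
    (if (a : ℕ) = b ∧ (c : ℕ) = d then (1 / 2 : ℂ) else 0) = (1 / 2 : ℂ) * ∑ k : Fin 2,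
      ∑ l : Fin 2, Matrix.single k l (1 : ℂ) a c * Matrix.single k l (1 : ℂ) b d := by
  fin_cases a <;> fin_cases b <;> fin_cases c <;> fin_cases d <;> simp [Matrix.single_apply]

theorem maxEntangled_eq_sum :
    maxEntangled = (1 / 2 : ℂ) • ∑ k, ∑ l, tensor (ancUnit k l) := by
  ext x y
  have h0 : x 0 = y 0 := Subsingleton.elim (α := Fin 1) _ _
  simp only [maxEntangled, Matrix.smul_apply, Matrix.sum_apply, tensor, Matrix.of_apply,
    Fin.prod_univ_three, ancUnit, Matrix.one_apply, if_pos h0, one_mul, smul_eq_mul]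
  exact sum_single_mul_single (x 1) (x 2) (y 1) (y 2)

theorem posSemidef_maxEntangled : maxEntangled.PosSemidef := by
  have : maxEntangled = (1 / 2 : ℂ) • Matrix.vecMulVec
      (fun x : ∀ i, Ancil i => if (x 1 : ℕ) = (x 2 : ℕ) then (1 : ℂ) else 0)
      (star fun x : ∀ i, Ancil i => if (x 1 : ℕ) = (x 2 : ℕ) then (1 : ℂ) else 0) := by
    ext x y
    simp only [maxEntangled, Matrix.of_apply, Matrix.smul_apply, Matrix.vecMulVec_apply,
      Pi.star_apply]
    split_ifs <;> simp_all
  rw [this]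
  exact (Matrix.posSemidef_vecMulVec_self_star _).smul (by norm_num [Complex.le_def])

/-- Expanding the entangled state in the operators |kk⟩⟨ll| reduces everything to products of
one-party traces; the prefactor is ¼ · ½. -/
theorem trace_extend_WABC_mul_tensor
    (M : ∀ i, Matrix ((Inp i × Ancil i) × Outp i) ((Inp i × Ancil i) × Outp i) ℂ) :
    (extend WABC maxEntangled * tensor M).trace = 1 / 8 * ∑ k, ∑ l,
      (∏ i, (((1 ⊗ₖ ancUnit k l i) ⊗ₖ 1) * M i).trace +
        ((1 / √2 : ℝ) : ℂ) * ∏ i, (((sIn i ⊗ₖ ancUnit k l i) ⊗ₖ sOut i) * M i).trace +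
        ((1 / √2 : ℝ) : ℂ) * ∏ i, (((tIn i ⊗ₖ ancUnit k l i) ⊗ₖ tOut i) * M i).trace) := by
  simp only [maxEntangled_eq_sum, WABC_eq_smul, extend_smul_right, extend_sum_right,
    extend_smul_left, extend_add_left, extend_tensor_kronecker, Finset.smul_sum, smul_mul_assoc,
    Finset.sum_mul, add_mul, Matrix.trace_smul, Matrix.trace_sum, Matrix.trace_add,
    trace_tensor_mul_tensor, smul_eq_mul, Finset.mul_sum]
  refine Finset.sum_congr rfl fun k _ => Finset.sum_congr rfl fun l _ => ?_
  ring

theorem exists_inputTraceless_s_ancUnit (k l : Fin 2) :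
    ∃ i, InputTraceless ((sIn i ⊗ₖ ancUnit k l i) ⊗ₖ sOut i) := by
  refine ⟨0, inputTraceless_kronecker_one ?_⟩
  rw [Matrix.trace_kronecker]
  exact mul_eq_zero_of_left trace_σz _

theorem exists_inputTraceless_t_ancUnit (k l : Fin 2) :
    ∃ i, InputTraceless ((tIn i ⊗ₖ ancUnit k l i) ⊗ₖ tOut i) := by
  refine ⟨1, inputTraceless_kronecker_one ?_⟩
  rw [Matrix.trace_kronecker]
  exact mul_eq_zero_of_left trace_σz _

theorem prod_trace_ancUnit (k l : Fin 2) :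
    ∏ i, (ancUnit k l i).trace = if k = l then 1 else 0 := by
  rw [Fin.prod_univ_three]
  change (1 : Matrix (Fin 1) (Fin 1) ℂ).trace * (Matrix.single k l (1 : ℂ)).trace *
    (Matrix.single k l (1 : ℂ)).trace = _
  split_ifs with h
  · subst h
    simp
  · rw [Matrix.trace_single_eq_of_ne _ _ _ h, mul_zero]

theorem isProcessMatrix_extend_WABC : IsProcessMatrix (extend WABC maxEntangled) := by
  refine ⟨posSemidef_extend isProcessMatrix_WABC.1 posSemidef_maxEntangled, fun M _ hM => ?_⟩
  have h1 (k l : Fin 2) (i : Fin 3) : (((1 ⊗ₖ ancUnit k l i) ⊗ₖ 1) * M i).trace =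
      Fintype.card (Inp i) * (ancUnit k l i).trace := by
    rw [trace_kronecker_one_mul, hM, mul_one, Matrix.trace_kronecker, Matrix.trace_one]
  have hs (k l : Fin 2) : ∏ i, (((sIn i ⊗ₖ ancUnit k l i) ⊗ₖ sOut i) * M i).trace = 0 := by
    obtain ⟨i, hi⟩ := exists_inputTraceless_s_ancUnit k l
    exact Finset.prod_eq_zero (Finset.mem_univ i) (hi _ (hM i))
  have ht (k l : Fin 2) : ∏ i, (((tIn i ⊗ₖ ancUnit k l i) ⊗ₖ tOut i) * M i).trace = 0 := by
    obtain ⟨i, hi⟩ := exists_inputTraceless_t_ancUnit k l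
    exact Finset.prod_eq_zero (Finset.mem_univ i) (hi _ (hM i))
  -- Only the identity term with `k = l` survives, giving `1 / 8 * (4 + 4) = 1`.
  rw [trace_extend_WABC_mul_tensor]
  simp only [h1, hs, ht, Finset.prod_mul_distrib, prod_card_inp, prod_trace_ancUnit, mul_zero,
    add_zero, mul_ite, mul_one, Finset.sum_ite_eq, Finset.mem_univ, if_true, Finset.sum_const,
    Finset.card_univ]
  norm_num

end Example

/-! ### Instruments from Kraus operators -/

section Kraus

variable {a b K : Type} [Fintype a] [Fintype K]

/-- The completely positive map with Kraus operators `E`. -/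
def krausMap (E : K → Matrix b a ℂ) : Matrix a a ℂ →ₗ[ℂ] Matrix b b ℂ where
  toFun σ := ∑ k, E k * σ * (E k).conjTranspose
  map_add' σ τ := by simp only [Matrix.mul_add, Matrix.add_mul, Finset.sum_add_distrib]
  map_smul' c σ := by simp only [Matrix.mul_smul, Matrix.smul_mul, Finset.smul_sum,
    RingHom.id_apply]

theorem krausMap_apply (E : K → Matrix b a ℂ) (σ : Matrix a a ℂ) :
    krausMap E σ = ∑ k, E k * σ * (E k).conjTranspose := rfl

theorem isCP_krausMap (E : K → Matrix b a ℂ) : IsCP (krausMap E) :=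
  ⟨Fintype.card K, fun k => E ((Fintype.equivFin K).symm k), fun σ =>
    (Equiv.sum_comp (Fintype.equivFin K).symm fun k => E k * σ * (E k).conjTranspose).symm⟩

/-- The instrument with Kraus operators `E`, where `lab k` is the outcome belonging to `E k`. -/
def krausInstrument [DecidableEq a] [Fintype b] (E : K → Matrix b a ℂ) (lab : K → ℕ)
    (h : ∑ k, (E k).conjTranspose * E k = 1) : Instrument a b where
  map j := krausMap fun k => if lab k = j then E k else 0
  isCP j := isCP_krausMap _
  tracePreserving := by
    refine ⟨(Finset.univ.sup lab) + 1, fun j hj => ?_, fun σ => ?_⟩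
    · ext1 σ
      refine Finset.sum_eq_zero fun k _ => ?_
      have : lab k ≠ j := by
        have := Finset.le_sup (f := lab) (Finset.mem_univ k)
        omega
      simp [this]
    · have hk (k : K) : ∑ j ∈ Finset.range ((Finset.univ.sup lab) + 1),
          ((if lab k = j then E k else 0) * σ * (if lab k = j then E k else 0).conjTranspose) =
          E k * σ * (E k).conjTranspose := by
        rw [Finset.sum_eq_single (lab k)]
        · rw [if_pos rfl]
        · intro j _ hj
          simp [hj.symm]
        · intro hk
          have := Finset.le_sup (f := lab) (Finset.mem_univ k)
          simp only [Finset.mem_range] at hk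
          omega
      simp only [krausMap_apply]
      rw [Finset.sum_comm, Finset.sum_congr rfl fun k _ => hk k, Matrix.trace_sum,
        Finset.sum_congr rfl fun k _ => (Matrix.trace_mul_comm (E k * σ) _),
        Finset.sum_congr rfl fun k _ => congrArg _ (Matrix.mul_assoc _ (E k) σ).symm,
        ← Matrix.trace_sum, ← Finset.sum_mul, h, one_mul]

variable [DecidableEq b]

/-- The operator `|f⟩ ∑ₚ vₚ ⟨p|`. -/
def measurePrepareOp (v : a → ℂ) (f : b) : Matrix b a ℂ :=
  Matrix.of fun r p => if r = f then v p else 0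

theorem trace_mul_measurePrepareOp [Fintype b] (F : Matrix b b ℂ) (σ : Matrix a a ℂ) (v : a → ℂ)
    (f : b) : (F * (measurePrepareOp v f * σ * (measurePrepareOp v f).conjTranspose)).trace =
      F f f * ∑ p, ∑ q, v p * σ p q * star (v q) := by
  simp only [measurePrepareOp, Matrix.trace, Matrix.diag, Matrix.mul_apply, Matrix.of_apply,
    Matrix.conjTranspose_apply, ite_mul, zero_mul, Finset.sum_ite_irrel, Finset.sum_const_zero,
    apply_ite star, star_zero, mul_ite, mul_zero, Finset.sum_ite_eq',
    Finset.mem_univ, if_true]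
  rw [Finset.sum_comm]
  simp only [Finset.sum_mul]

/-- The instrument that measures the functionals `v k` and, upon result `k`, yields the outcome
`lab k` and prepares the basis state `f k`. -/
def measurePrepare [DecidableEq a] [Fintype b] (v : K → a → ℂ) (f : K → b) (lab : K → ℕ)
    (h : ∀ p q, ∑ k, star (v k p) * v k q = if p = q then 1 else 0) : Instrument a b :=
  krausInstrument (fun k => measurePrepareOp (v k) (f k)) lab (by
    ext p q
    rw [Matrix.sum_apply, Matrix.one_apply, ← h]
    refine Finset.sum_congr rfl fun k _ => ?_
    simp [measurePrepareOp, Matrix.mul_apply, apply_ite star])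

theorem trace_kronecker_mul_choi_measurePrepare [DecidableEq a] [Fintype b] (v : K → a → ℂ)
    (f : K → b) (lab : K → ℕ) (h) (j : ℕ) (D : Matrix a a ℂ) (F : Matrix b b ℂ) :
    ((D ⊗ₖ F) * choi ((measurePrepare v f lab h).map j)).trace =
      ∑ k, if lab k = j then F (f k) (f k) * ∑ p, ∑ q, v k p * D p q * star (v k q) else 0 := by
  rw [trace_kronecker_mul_choi]
  rw [measurePrepare, krausInstrument, krausMap_apply, Finset.mul_sum, Matrix.trace_sum]
  refine Finset.sum_congr rfl fun k _ => ?_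
  by_cases hk : lab k = j
  · simp only [if_pos hk]
    rw [trace_mul_measurePrepareOp, Matrix.transpose_apply]
  · simp only [if_neg hk, mul_zero, Matrix.zero_mul, Matrix.trace_zero]

end Kraus

/-! ### The strategy violating the OCB inequality -/

/-- Alice's operation: measure the input qubit in the computational basis, and prepare the output
qubit in the state `|a⟩`. -/
noncomputable def aliceInstrument (a : Fin 2) : Instrument (Fin 2 × Fin 1) (Fin 2) :=
  measurePrepare (fun k : Fin 2 => Pi.single (k, 0) 1) (fun _ => a) (fun k => k) (by
    intro p q
    obtain ⟨p, p'⟩ := p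
    obtain ⟨q, q'⟩ := q
    fin_cases p <;> fin_cases p' <;> fin_cases q <;> fin_cases q' <;> simp [Pi.single_apply])

/-- Bob's operation for guessing Alice's bit: measure the parity of his two qubits in the
computational basis. -/
noncomputable def bobGuess : Instrument (Fin 2 × Fin 2) (Fin 2) :=
  measurePrepare (fun k : Fin 2 × Fin 2 => Pi.single k 1) (fun _ => 0)
    (fun k => (k.1 + k.2 : Fin 2)) (by
    intro p q
    simp [Pi.single_apply])

/-- Bob's operation for sending the bit `b` to Alice: measure his input in the computational basis,
with result `i`, and his ancilla in the conjugate basis, with result `m`, and prepare the output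
qubit in the state `|i + m + b⟩`. -/
noncomputable def bobSend (b : Fin 2) : Instrument (Fin 2 × Fin 2) (Fin 2) :=
  measurePrepare (fun (k p : Fin 2 × Fin 2) => if k.1 = p.1 then
      ((1 / √2 : ℝ) : ℂ) * (-1) ^ ((k.2 : ℕ) * (p.2 : ℕ)) else 0)
    (fun k => k.1 + k.2 + b) (fun _ => 0) (by
    have h := ofReal_inv_sqrt_two_mul_self
    generalize hc : (1 / √2 : ℝ) = c at h
    intro p q
    obtain ⟨p, p'⟩ := p
    obtain ⟨q, q'⟩ := q
    fin_cases p <;> fin_cases p' <;> fin_cases q <;> fin_cases q' <;>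
      simp [Fintype.sum_prod_type, h] <;> norm_num)

/-- The identity channel from the ancilla. -/
noncomputable def charlieInstrument : Instrument (Fin 1 × Fin 2) (Fin 2) :=
  krausInstrument (K := Unit) (fun _ => Matrix.of fun r p => if r = p.2 then 1 else 0)
    (fun _ => 0) (by
    ext p q
    obtain ⟨p, p'⟩ := p
    obtain ⟨q, q'⟩ := q
    fin_cases p
    fin_cases p' <;> fin_cases q <;> fin_cases q' <;> simp [Matrix.mul_apply])

theorem charlieInstrument_map_zero (σ : Matrix (Fin 1 × Fin 2) (Fin 1 × Fin 2) ℂ) (k l : Fin 2) :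
    charlieInstrument.map 0 σ k l = σ (0, k) (0, l) := by
  simp [charlieInstrument, krausInstrument, krausMap_apply, Matrix.mul_apply,
    Fintype.sum_prod_type, apply_ite star]

theorem trace_alice (a x : Fin 2) (D F : Matrix (Fin 2) (Fin 2) ℂ) :
    (((D ⊗ₖ (1 : Matrix (Fin 1) (Fin 1) ℂ)) ⊗ₖ F) * choi ((aliceInstrument a).map x)).trace =
      F a a * D x x := by
  rw [aliceInstrument, trace_kronecker_mul_choi_measurePrepare]
  fin_cases x <;> simp [Pi.single_apply]

theorem trace_bobGuess (y k l : Fin 2) (D F : Matrix (Fin 2) (Fin 2) ℂ) :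
    (((D ⊗ₖ Matrix.single k l (1 : ℂ)) ⊗ₖ F) * choi (bobGuess.map y)).trace =
      F 0 0 * if k = l then D (y + k) (y + k) else 0 := by
  rw [bobGuess, trace_kronecker_mul_choi_measurePrepare]
  fin_cases y <;> fin_cases k <;> fin_cases l <;>
    simp [Fintype.sum_prod_type, Pi.single_apply, Matrix.single_apply]

theorem trace_bobSend (b k l : Fin 2) (D F : Matrix (Fin 2) (Fin 2) ℂ) :
    (((D ⊗ₖ Matrix.single k l (1 : ℂ)) ⊗ₖ F) * choi ((bobSend b).map 0)).trace =
      1 / 2 * ∑ i, ∑ m : Fin 2, F (i + m + b) (i + m + b) * D i i *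
        (-1) ^ ((m : ℕ) * ((k : ℕ) + l)) := by
  rw [bobSend, trace_kronecker_mul_choi_measurePrepare]
  have h := ofReal_inv_sqrt_two_mul_self
  generalize hc : (1 / √2 : ℝ) = c at h
  rw [← h]
  fin_cases k <;> fin_cases l <;>
    simp [Fintype.sum_prod_type, Matrix.single_apply] <;> ring

/-- The sum of `F k l` |k⟩⟨l| over `k, l` is `F` itself, so Charlie's operator reappears on Bob's
ancilla. -/
theorem trace_charlie (k l : Fin 2) (F : Matrix (Fin 2) (Fin 2) ℂ) :
    ((((1 : Matrix (Fin 1) (Fin 1) ℂ) ⊗ₖ Matrix.single k l (1 : ℂ)) ⊗ₖ F) *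
      choi (charlieInstrument.map 0)).trace = F k l := by
  rw [trace_kronecker_mul_choi]
  simp only [Matrix.trace, Matrix.diag, Matrix.mul_apply, charlieInstrument_map_zero]
  fin_cases k <;> fin_cases l <;> simp [Matrix.single_apply]

theorem toReal_apply_of_describes {P : InstrProcess (fun i => Inp i × Ancil i) Outp}
    (hP : Describes (extend WABC maxEntangled) P)
    {s : ∀ i, Instrument (Inp i × Ancil i) (Outp i)} {tA : Instrument (Fin 2 × Fin 1) (Fin 2)}
    {tB : Instrument (Fin 2 × Fin 2) (Fin 2)} {tC : Instrument (Fin 1 × Fin 2) (Fin 2)}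
    (hA : s 0 = tA) (hB : s 1 = tB) (hC : s 2 = tC) (x y w : ℕ) :
    ((P s ![x, y, w]).toReal : ℂ) = 1 / 8 * ∑ k : Fin 2, ∑ l : Fin 2,
      ((((1 ⊗ₖ 1) ⊗ₖ 1) * choi (tA.map x)).trace *
        (((1 ⊗ₖ Matrix.single k l 1) ⊗ₖ 1) * choi (tB.map y)).trace *
        (((1 ⊗ₖ Matrix.single k l 1) ⊗ₖ 1) * choi (tC.map w)).trace +
      ((1 / √2 : ℝ) : ℂ) * ((((σz ⊗ₖ 1) ⊗ₖ 1) * choi (tA.map x)).trace *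
        (((σz ⊗ₖ Matrix.single k l 1) ⊗ₖ σz) * choi (tB.map y)).trace *
        (((1 ⊗ₖ Matrix.single k l 1) ⊗ₖ σx) * choi (tC.map w)).trace) +
      ((1 / √2 : ℝ) : ℂ) * ((((1 ⊗ₖ 1) ⊗ₖ σz) * choi (tA.map x)).trace *
        (((σz ⊗ₖ Matrix.single k l 1) ⊗ₖ 1) * choi (tB.map y)).trace *
        (((1 ⊗ₖ Matrix.single k l 1) ⊗ₖ σz) * choi (tC.map w)).trace)) := by
  subst hA hB hC
  rw [hP, trace_extend_WABC_mul_tensor]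
  simp only [Fin.prod_univ_three]
  rfl

section Violation

variable {P : InstrProcess (fun i => Inp i × Ancil i) Outp}
  {s : ∀ i, Instrument (Inp i × Ancil i) (Outp i)}

/-- In the `S` term, Bob's signs `(-1)^i`, `(-1)^(i+m+b)` and `(-1)^m` multiply to `(-1)^b`, which
Alice's result reproduces. The `T` term vanishes on summing `(-1)^i`. -/
theorem toReal_apply_send (hP : Describes (extend WABC maxEntangled) P) {a b : Fin 2}
    (hA : s 0 = aliceInstrument a) (hB : s 1 = bobSend b) (hC : s 2 = charlieInstrument) :
    (P s ![b, 0, 0]).toReal = (1 + 1 / √2) / 2 := by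
  apply Complex.ofReal_injective
  rw [toReal_apply_of_describes hP hA hB hC]
  simp only [trace_alice, trace_bobSend, trace_charlie, Complex.ofReal_div, Complex.ofReal_add,
    Complex.ofReal_one, Complex.ofReal_ofNat]
  generalize (√2 : ℂ) = c
  fin_cases a <;> fin_cases b <;> simp [σz, σx, Fin.sum_univ_two] <;> ring

/-- In the `T` term, Alice's `(-1)^a` meets the parity sign `(-1)^y`. The `S` term vanishes since σx
has zero diagonal, so Alice's own result is uniform. -/
theorem toReal_apply_guess (hP : Describes (extend WABC maxEntangled) P) {a : Fin 2} (x : Fin 2)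
    (hA : s 0 = aliceInstrument a) (hB : s 1 = bobGuess) (hC : s 2 = charlieInstrument) :
    (P s ![x, a, 0]).toReal = (1 + 1 / √2) / 4 := by
  apply Complex.ofReal_injective
  rw [toReal_apply_of_describes hP hA hB hC]
  simp only [trace_alice, trace_bobGuess, trace_charlie, Complex.ofReal_div, Complex.ofReal_add,
    Complex.ofReal_one, Complex.ofReal_ofNat]
  generalize (√2 : ℂ) = c
  fin_cases a <;> fin_cases x <;> simp [σz, σx, Fin.sum_univ_two] <;> ring

theorem le_prob_send (hP : Describes (extend WABC maxEntangled) P) {a b : Fin 2}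
    (hA : s 0 = aliceInstrument a) (hB : s 1 = bobSend b) (hC : s 2 = charlieInstrument) :
    (1 + 1 / √2) / 2 ≤ ((P s).toOuterMeasure {o | o 0 = (b : ℕ)}).toReal := by
  rw [← toReal_apply_send hP hA hB hC]
  refine ENNReal.toReal_mono (toOuterMeasure_ne_top _ _) ?_
  rw [← Finset.sum_singleton (P s) ![(b : ℕ), 0, 0], ← PMF.toOuterMeasure_apply_finset]
  refine (P s).toOuterMeasure.mono ?_
  simp

theorem le_prob_guess (hP : Describes (extend WABC maxEntangled) P) {a : Fin 2}
    (hA : s 0 = aliceInstrument a) (hB : s 1 = bobGuess) (hC : s 2 = charlieInstrument) :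
    (1 + 1 / √2) / 2 ≤ ((P s).toOuterMeasure {o | o 1 = (a : ℕ)}).toReal := by
  have h : (1 + 1 / √2) / 2 = (P s ![((0 : Fin 2) : ℕ), a, 0]).toReal +
      (P s ![((1 : Fin 2) : ℕ), a, 0]).toReal := by
    rw [toReal_apply_guess hP 0 hA hB hC, toReal_apply_guess hP 1 hA hB hC]
    ring
  rw [h, ← ENNReal.toReal_add (PMF.apply_ne_top _ _) (PMF.apply_ne_top _ _)]
  refine ENNReal.toReal_mono (toOuterMeasure_ne_top _ _) ?_
  rw [← Finset.sum_pair (fun h => by simpa using congrFun h 0),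
    ← PMF.toOuterMeasure_apply_finset]
  refine (P s).toOuterMeasure.mono ?_
  simp [Set.insert_subset_iff]

theorem exists_lt_ocbSuccess (hP : Describes (extend WABC maxEntangled) P) :
    ∃ (s₀ : ∀ i, Instrument (Inp i × Ancil i) (Outp i))
      (α : Fin 2 → Instrument (Inp 0 × Ancil 0) (Outp 0))
      (β : Fin 2 → Fin 2 → Instrument (Inp 1 × Ancil 1) (Outp 1)),
      IsCharlieIdentity (s₀ 2) ∧ 3 / 4 < ocbSuccess P 0 1 s₀ α β := by
  let s₀ : ∀ i, Instrument (Inp i × Ancil i) (Outp i)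
    | 0 => aliceInstrument 0
    | 1 => bobGuess
    | 2 => charlieInstrument
  let α : Fin 2 → Instrument (Inp 0 × Ancil 0) (Outp 0) := aliceInstrument
  let β : Fin 2 → Fin 2 → Instrument (Inp 1 × Ancil 1) (Outp 1) := fun b c =>
    if c = 0 then bobSend b else bobGuess
  have hx (a b : Fin 2) := le_prob_send hP (a := a) (b := b)
    (s := Function.update (Function.update s₀ 0 (α a)) 1 (β b 0)) rfl rfl rfl
  have hy (a b : Fin 2) := le_prob_guess hP (a := a)
    (s := Function.update (Function.update s₀ 0 (α a)) 1 (β b 1)) rfl rfl rfl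
  refine ⟨s₀, α, β, charlieInstrument_map_zero, ?_⟩
  have h2 : 1 / 2 < 1 / √2 := by
    rw [one_div_lt_one_div (by norm_num) (by positivity), Real.sqrt_lt' (by norm_num)]
    norm_num
  rw [ocbSuccess]
  simp only [Fin.sum_univ_two]
  linarith [hx 0 0, hx 0 1, hx 1 0, hx 1 1, hy 0 0, hy 0 1, hy 1 0, hy 1 1]

end Violation

end ProcessFramework

theorem mainTheorem4 :
    IsProcessMatrix WABC ∧
    (∃ P : InstrProcess Inp Outp,
      Describes WABC P ∧
      IsCausallySeparable P ∧ IsCausal P) ∧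
    (∀ (n : ℕ) (S : Fin n → Type) (P : CondProcess S (fun _ => ℕ)),
      IsCausal P →
      ∀ (A B : Fin n), A ≠ B →
      ∀ (s₀ : ∀ i, S i) (α : Fin 2 → S A) (β : Fin 2 → Fin 2 → S B),
        ocbSuccess P A B s₀ α β ≤ 3 / 4) ∧
    IsProcessMatrix
      (extend WABC maxEntangled) ∧
    (∃ P' : InstrProcess
        (fun i => Inp i × Ancil i) Outp,
      Describes
        (extend WABC maxEntangled) P' ∧
      ¬ IsCausal P' ∧
      ∃ (s₀ : ∀ i, Instrument
          (Inp i × Ancil i) (Outp i))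
        (α : Fin 2 → Instrument
          (Inp 0 × Ancil 0) (Outp 0))
        (β : Fin 2 → Fin 2 → Instrument
          (Inp 1 × Ancil 1) (Outp 1)),
        IsCharlieIdentity (s₀ 2) ∧
        3 / 4 < ocbSuccess P' 0 1 s₀ α β) := by
  obtain ⟨P', hP'⟩ := isProcessMatrix_extend_WABC.exists_describes
  obtain ⟨s₀, α, β, hC, h⟩ := exists_lt_ocbSuccess hP'
  exact ⟨isProcessMatrix_WABC, exists_describes_WABC,
    fun _ _ _ hP _ _ hAB s₀ α β => hP.ocbSuccess_le hAB s₀ α β, isProcessMatrix_extend_WABC,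
    P', hP', fun hP => h.not_ge (hP.ocbSuccess_le (by decide) s₀ α β), s₀, α, β, hC, h⟩
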